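/- **Setting.** Let $G$ be a (real, smooth) Lie group of finite dimension $d$ with identity $e$ and Lie algebra $\mathcal G=T_eG$. A *continuous representation* of $G$ on a complex topological vector space $\Psi$ is a homomorphism $g\mapsto\mathcal T(g)$ from $G$ to the invertible linear operators on $\Psi$ (so $\mathcal T(e)=I$) such that $(g,\psi)\mapsto\mathcal T(g)\psi$ is continuous on $G\times\Psi$. It is *differentiable* if moreover $\Psi$ is complete and, for every one-parameter subgroup $\gamma:\mathbb R\to G$ (smooth homomorphism), the limit $\lim_{t\to0}\frac{\mathcal T(\gamma(t))\psi-\psi}{t}$ exists for every $\psi\in\Psi$ and defines a continuous linear operator on $\Psi$. Let $\mathcal T$ be a continuous representation of $G$ on a complex Hilbert space $\mathcal H$. Its differential at $e$ is $T(x)\varphi=d(g\mapsto\mathcal T(g)\varphi)|_e(x)$, $x\in\mathcal G$, defined on the vectors $\varphi$ whose orbit map $g\mapsto\mathcal T(g)\varphi$ is differentiable at $e$. Let $\mathcal D\subset\mathcal H$ be a dense linear subspace contained in this domain with $\mathcal T(g)\mathcal D\subset\mathcal D$ for all $g\in G$ and $T(x)\mathcal D\subset\mathcal D$ for all $x\in\mathcal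 G$. Let $x_1,\dots,x_d$ be any basis of $\mathcal G$, $X_i=T(x_i)|_{\mathcal D}$, and define scalar products on $\mathcal D$ by $(\varphi,\psi)_0=(\varphi,\psi)$, $(\varphi,\psi)_{n+1}=\sum_{i=1}^d(X_i\varphi,X_i\psi)_n+(\varphi,\psi)_n$, so that $\|\varphi\|_{n+1}^2=\sum_{i=1}^d\|X_i\varphi\|_n^2+\|\varphi\|_n^2$. Let $\mathcal H_n$ be the completion of $\mathcal D$ in $\|\cdot\|_n$ and let $\Phi=\varprojlim\mathcal H_n$ along the maps $\mathcal H_{n+1}\to\mathcal H_n$ that extend the identity of $\mathcal D$, with the projective limit topology $\tau_\Phi$. **Proposition.** 1. The maps $\mathcal H_n\to\mathcal H$ extending the inclusion $\mathcal D\subset\mathcal H$ are injective and compatible with the maps $\mathcal H_{n+1}\to\mathcal H_n$, so that $\mathcal H\supset\mathcal H_1\supset\mathcal H_2\supset\cdots$, and under them $\Phi=\bigcap_n\mathcal H_n$. The triple $\Phi\subset\mathcal H\subset\Phi^\times$ is a rigged Hilbert space, that is: $\Phi$ is a dense subspace of $\mathcal H$, complete and locally convex in $\tau_\Phi$, which is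 stronger than the topology of $\mathcal H$; and the space $\Phi^\times$ of continuous antilinear functionals on $\Phi$ is sequentially complete in its weak* topology and contains $\mathcal H$ as a weak*-dense subspace, by the injective weak*-continuous map $h\mapsto(\,\cdot\,,h)$. 2. The operators $\mathcal T(g)$ map $\Phi$ into $\Phi$, and their restrictions $\mathcal T(g)|_\Phi$ form a continuous representation of $G$ on $\Phi$ (for $\tau_\Phi$). 3. Suppose that $\mathcal D$ is complete in the projective topology, i.e. the topology defined by the norms $\|\cdot\|_n$, $n\ge0$. Then $\mathcal T|_\Phi$ is a differentiable representation of $G$ on $\Phi$. Moreover the dual representation $\mathcal V$ of $G$ on $\Phi^\times$, $(\mathcal V(g)F)(\varphi)=F(\mathcal T(g^{-1})\varphi)$, is differentiable in the following two senses. - For the weak* topology: every operator $\mathcal V(g)$ and every orbit map $g\mapsto\mathcal V(g)F$ is continuous, $(g,F)\mapsto\mathcal V(g)F$ is sequentially continuous on $G\times\Phi^\times$, and for every one-parameter subgroup $\gamma$ the weak* limit $\lim_{t\to0}\frac{\mathcal V(\gamma(t))F-F}{t}$ exists for every $F\in\Phi^\times$ and defines a weak*-continuous linear operator on $\Phi^\times$.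 - For the strong topology (uniform convergence on bounded subsets of $\Phi$): $\Phi^\times$ is complete and $\mathcal V$ is a differentiable representation of $G$ on $\Phi^\times$ exactly as defined above. -/

import Mathlib

open Set Filter Topology UniformSpace
open scoped Manifold ContDiff InnerProductSpace

noncomputable section

/-! ### Representations of a Lie group on topological vector spaces -/

section Representations

variable {G Ψ : Type*} [Group G] [AddCommGroup Ψ] [Module ℂ Ψ]

/-- A representation by linear operators (`ρ 1 = id`, `ρ (g * h) = ρ g ∘ ρ h`) is continuous if
the map `(g, ψ) ↦ ρ g ψ` is continuous on `G × Ψ`. -/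
def IsContinuousRep [TopologicalSpace G] [TopologicalSpace Ψ] (ρ : Representation ℂ G Ψ) : Prop :=
  Continuous fun p : G × Ψ => ρ p.1 p.2

/-- One-parameter subgroups of a Lie group: smooth homomorphisms `ℝ → G`. -/
def IsOneParameterSubgroup (E : Type*) [NormedAddCommGroup E] [NormedSpace ℝ E]
    [TopologicalSpace G] [ChartedSpace E G] (γ : ℝ → G) : Prop :=
  (∀ s t : ℝ, γ (s + t) = γ s * γ t) ∧ ContMDiff 𝓘(ℝ, ℝ) 𝓘(ℝ, E) ∞ γ

/-- Along every one-parameter subgroup `γ`, the limit of `(ρ (γ t) ψ - ψ) / t` as `t → 0`, `t ≠ 0`,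
exists for every `ψ`, and it defines a continuous linear operator on `Ψ`. -/
def HasGenerators (E : Type*) [NormedAddCommGroup E] [NormedSpace ℝ E]
    [TopologicalSpace G] [ChartedSpace E G] [TopologicalSpace Ψ]
    (ρ : Representation ℂ G Ψ) : Prop :=
  ∀ γ : ℝ → G, IsOneParameterSubgroup E γ → ∃ A : Ψ →L[ℂ] Ψ, ∀ ψ : Ψ,
    Tendsto (fun t : ℝ => ((t : ℂ)⁻¹) • (ρ (γ t) ψ - ψ)) (𝓝[≠] 0) (𝓝 (A ψ))

/-- Differentiable representation on a complete topological vector space. -/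
structure IsDifferentiableRep (E : Type*) [NormedAddCommGroup E] [NormedSpace ℝ E]
    [TopologicalSpace G] [ChartedSpace E G] [UniformSpace Ψ]
    (ρ : Representation ℂ G Ψ) : Prop where
  complete : CompleteSpace Ψ
  continuous : IsContinuousRep ρ
  generators : HasGenerators E ρ

/-- Every Cauchy sequence converges. -/
def IsSeqCompleteSpace (Ψ : Type*) [UniformSpace Ψ] : Prop :=
  ∀ u : ℕ → Ψ, CauchySeq u → ∃ ψ : Ψ, Tendsto u atTop (𝓝 ψ)

/-- The version of differentiability for a space that is only sequentially complete (such as a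
weak* dual): every operator is continuous, every orbit map is continuous, the map
`(g, ψ) ↦ ρ g ψ` is sequentially continuous, and the generators exist everywhere and are
continuous. -/
structure IsSeqDifferentiableRep (E : Type*) [NormedAddCommGroup E] [NormedSpace ℝ E]
    [TopologicalSpace G] [ChartedSpace E G] [UniformSpace Ψ]
    (ρ : Representation ℂ G Ψ) : Prop where
  complete : IsSeqCompleteSpace Ψ
  continuous_operator : ∀ g : G, Continuous (ρ g)
  continuous_orbit : ∀ ψ : Ψ, Continuous fun g : G => ρ g ψ
  seqContinuous : SeqContinuous fun p : G × Ψ => ρ p.1 p.2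
  generators : HasGenerators E ρ

end Representations

/-! ### Rigged Hilbert spaces -/

section Rigged

variable {Φ H : Type*} [NormedAddCommGroup H] [InnerProductSpace ℂ H]
  [AddCommGroup Φ] [Module ℂ Φ]

/-- The space of continuous antilinear functionals with the weak* topology. -/
abbrev WeakAntidual (Φ : Type*) [AddCommGroup Φ] [Module ℂ Φ] [TopologicalSpace Φ] : Type _ :=
  PointwiseConvergenceCLM (starRingEnd ℂ) Φ ℂ

/-- The space of continuous antilinear functionals with the strong topology (uniform convergence
on bounded sets). -/
abbrev StrongAntidual (Φ : Type*) [AddCommGroup Φ] [Module ℂ Φ] [TopologicalSpace Φ] : Type _ :=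
  Φ →L⋆[ℂ] ℂ

/-- A vector `h` of the Hilbert space as the antilinear functional `φ ↦ ⟪j φ, h⟫`
(Mathlib's inner product is antilinear in the first variable). -/
def toAntidual [TopologicalSpace Φ] (j : Φ →L[ℂ] H) : H →ₗ[ℂ] WeakAntidual Φ where
  toFun h := (innerSLFlip ℂ h).comp j
  map_add' x y := ContinuousLinearMap.ext fun φ => inner_add_right (𝕜 := ℂ) (j φ) x y
  map_smul' c x := ContinuousLinearMap.ext fun φ => inner_smul_right (𝕜 := ℂ) (j φ) x c

/-- `Φ ⊂ H ⊂ Φ^×` is a rigged Hilbert space, `j` being the inclusion of `Φ` in `H`; that the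
topology of `Φ` is stronger than that of `H` is the continuity of `j`, which is part of its type. -/
structure IsRiggedHilbertSpace [UniformSpace Φ] (j : Φ →L[ℂ] H) : Prop where
  complete_hilbert : CompleteSpace H
  locallyConvex : LocallyConvexSpace ℝ Φ
  complete : CompleteSpace Φ
  injective : Function.Injective j
  dense : DenseRange j
  antidual_complete : IsSeqCompleteSpace (WeakAntidual Φ)
  antidual_injective : Function.Injective (toAntidual j)
  antidual_continuous : Continuous (toAntidual j)
  antidual_dense : DenseRange (toAntidual j)

end Rigged

/-! ### The Hilbert scale of a finite family of operators, and its projective limit -/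

section Scale

variable {H : Type*} [NormedAddCommGroup H] [InnerProductSpace ℂ H] {D : Submodule ℂ H}
  {ι : Type*} [Fintype ι] (X : ι → D →ₗ[ℂ] D)

/-- `(φ, ψ)₀ = (φ, ψ)` and `(φ, ψ)ₙ₊₁ = ∑ᵢ (Xᵢ φ, Xᵢ ψ)ₙ + (φ, ψ)ₙ`. -/
def scaleInner : ℕ → D → D → ℂ
  | 0, φ, ψ => inner ℂ (φ : H) (ψ : H)
  | n + 1, φ, ψ => ∑ i, scaleInner n (X i φ) (X i ψ) + scaleInner n φ ψ

lemma scaleInner_conj (n : ℕ) (φ ψ : D) :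
    (starRingEnd ℂ) (scaleInner X n ψ φ) = scaleInner X n φ ψ := by
  induction n generalizing φ ψ with
  | zero => simp [scaleInner]
  | succ n ih => simp [scaleInner, ih]

lemma scaleInner_add (n : ℕ) (φ φ' ψ : D) :
    scaleInner X n (φ + φ') ψ = scaleInner X n φ ψ + scaleInner X n φ' ψ := by
  induction n generalizing φ φ' ψ with
  | zero => exact inner_add_left (φ : H) φ' ψ
  | succ n ih => simp only [scaleInner, map_add, ih, Finset.sum_add_distrib]; ring

lemma scaleInner_smul (n : ℕ) (φ ψ : D) (c : ℂ) :
    scaleInner X n (c • φ) ψ = (starRingEnd ℂ) c * scaleInner X n φ ψ := by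
  induction n generalizing φ ψ with
  | zero => exact inner_smul_left (φ : H) ψ c
  | succ n ih => simp only [scaleInner, map_smul, ih, ← Finset.mul_sum]; ring

lemma scaleInner_nonneg (n : ℕ) (φ : D) : 0 ≤ (scaleInner X n φ φ).re := by
  induction n generalizing φ with
  | zero => exact inner_self_nonneg (𝕜 := ℂ)
  | succ n ih =>
    simp only [scaleInner, Complex.add_re, Complex.re_sum]
    exact add_nonneg (Finset.sum_nonneg fun i _ => ih _) (ih _)

lemma scaleInner_re_le (n : ℕ) (φ : D) :
    (scaleInner X n φ φ).re ≤ (scaleInner X (n + 1) φ φ).re := by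
  simp only [scaleInner, Complex.add_re, Complex.re_sum]
  exact le_add_of_nonneg_left (Finset.sum_nonneg fun i _ => scaleInner_nonneg X n _)

lemma norm_sq_le_scaleInner (n : ℕ) (φ : D) : ‖φ‖ ^ 2 ≤ (scaleInner X n φ φ).re := by
  induction n with
  | zero => exact (norm_sq_eq_re_inner (𝕜 := ℂ) (φ : H)).le
  | succ n ih => exact ih.trans (scaleInner_re_le X n φ)

/-- The vector space `D` with the scalar product `(·, ·)ₙ`. -/
def PreScale (_X : ι → D →ₗ[ℂ] D) (_n : ℕ) : Type _ := D

namespace PreScale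

variable (n : ℕ)

instance instAddCommGroup : AddCommGroup (PreScale X n) := inferInstanceAs (AddCommGroup D)

instance instModule : Module ℂ (PreScale X n) := inferInstanceAs (Module ℂ D)

/-- The identity map `D → PreScale X n`. -/
def of : D ≃ₗ[ℂ] PreScale X n := LinearEquiv.refl ℂ D

/-- The scalar product `(·, ·)ₙ` with the scalar product axioms. -/
@[reducible] def core : InnerProductSpace.Core ℂ (PreScale X n) where
  inner φ ψ := scaleInner X n ((of X n).symm φ) ((of X n).symm ψ)
  conj_inner_symm φ ψ := scaleInner_conj X n _ _
  re_inner_nonneg φ := scaleInner_nonneg X n _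
  add_left φ φ' ψ := by simp [scaleInner_add]
  smul_left φ ψ c := by simp [scaleInner_smul]
  definite φ h := by
    have h1 := norm_sq_le_scaleInner X n ((of X n).symm φ)
    rw [h] at h1
    have h2 : ‖(of X n).symm φ‖ = 0 := by
      have h3 : ‖(of X n).symm φ‖ ^ 2 = 0 := le_antisymm (by simpa using h1) (sq_nonneg _)
      exact pow_eq_zero_iff (two_ne_zero) |>.1 h3
    simpa using norm_eq_zero.1 h2

instance instNormedAddCommGroup : NormedAddCommGroup (PreScale X n) :=
  (core X n).toNormedAddCommGroup

instance instInnerProductSpace : InnerProductSpace ℂ (PreScale X n) :=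
  InnerProductSpace.ofCore (core X n).toCore

lemma norm_sq_of (φ : D) : ‖of X n φ‖ ^ 2 = (scaleInner X n φ φ).re :=
  norm_sq_eq_re_inner (𝕜 := ℂ) (of X n φ)

lemma norm_of_zero (φ : D) : ‖of X 0 φ‖ = ‖φ‖ := by
  have h : ‖of X 0 φ‖ ^ 2 = ‖φ‖ ^ 2 := by
    rw [norm_sq_of]; exact (norm_sq_eq_re_inner (𝕜 := ℂ) (φ : H)).symm
  exact (sq_eq_sq₀ (norm_nonneg _) (norm_nonneg _)).1 h

/-- `‖φ‖²ₙ₊₁ = ∑ᵢ ‖Xᵢ φ‖²ₙ + ‖φ‖²ₙ`. -/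
lemma norm_sq_of_succ (φ : D) :
    ‖of X (n + 1) φ‖ ^ 2 = ∑ i, ‖of X n (X i φ)‖ ^ 2 + ‖of X n φ‖ ^ 2 := by
  simp [norm_sq_of, scaleInner, Complex.re_sum]

lemma norm_of_le_succ (φ : D) : ‖of X n φ‖ ≤ ‖of X (n + 1) φ‖ := by
  refine (sq_le_sq₀ (norm_nonneg _) (norm_nonneg _)).1 ?_
  rw [norm_sq_of, norm_sq_of]
  exact scaleInner_re_le X n φ

lemma norm_le_norm_of (φ : D) : ‖φ‖ ≤ ‖of X n φ‖ := by
  refine (sq_le_sq₀ (norm_nonneg _) (norm_nonneg _)).1 ?_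
  rw [norm_sq_of]
  exact norm_sq_le_scaleInner X n φ

/-- The identity of `D` as a bounded map from the norm `‖·‖ₙ₊₁` to the norm `‖·‖ₙ`. -/
def step : PreScale X (n + 1) →L[ℂ] PreScale X n :=
  LinearMap.mkContinuous ((of X n).toLinearMap ∘ₗ (of X (n + 1)).symm.toLinearMap) 1 fun φ => by
    simpa using norm_of_le_succ X n ((of X (n + 1)).symm φ)

end PreScale

/-- The Hilbert space `Hₙ`: the completion of `D` in the norm `‖·‖ₙ`. -/
def HilbertScale (n : ℕ) : Type _ := Completion (PreScale X n)

namespace HilbertScale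

variable (n : ℕ)

instance instNormedAddCommGroup : NormedAddCommGroup (HilbertScale X n) :=
  inferInstanceAs (NormedAddCommGroup (Completion (PreScale X n)))

instance instInnerProductSpace : InnerProductSpace ℂ (HilbertScale X n) :=
  inferInstanceAs (InnerProductSpace ℂ (Completion (PreScale X n)))

instance instCompleteSpace : CompleteSpace (HilbertScale X n) :=
  inferInstanceAs (CompleteSpace (Completion (PreScale X n)))

/-- The isometric embedding of `D`, with the norm `‖·‖ₙ`, in its completion `Hₙ`. -/
def coe : PreScale X n →L[ℂ] HilbertScale X n :=
  (Completion.toComplL : PreScale X n →L[ℂ] Completion (PreScale X n))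

lemma norm_coe (φ : PreScale X n) : ‖coe X n φ‖ = ‖φ‖ := Completion.norm_coe φ

lemma denseRange_coe : DenseRange (coe X n) := Completion.denseRange_coe

/-- The map `Hₙ₊₁ → Hₙ` that extends the identity of `D`. -/
def step : HilbertScale X (n + 1) →L[ℂ] HilbertScale X n :=
  (PreScale.step X n).completion

lemma step_coe (φ : D) :
    step X n (coe X (n + 1) (PreScale.of X (n + 1) φ)) = coe X n (PreScale.of X n φ) :=
  (PreScale.step X n).completion_apply_coe (PreScale.of X (n + 1) φ)

end HilbertScale

/-- The projective limit `Φ` of `H₀ ← H₁ ← H₂ ← ⋯`, with the projective limit topology: the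
compatible sequences in `∏ₙ Hₙ`, with the topology induced by the product topology. -/
def ProjLimit : Submodule ℂ (∀ n, HilbertScale X n) where
  carrier := {f | ∀ n, HilbertScale.step X n (f (n + 1)) = f n}
  add_mem' hf hg n := by simp [hf n, hg n]
  zero_mem' n := by simp
  smul_mem' c f hf n := by simp [hf n]

instance ProjLimit.instIsUniformAddGroup : IsUniformAddGroup (ProjLimit X) :=
  (ProjLimit X).toAddSubgroup.isUniformAddGroup

/-- The projective topology on `D`: the coarsest one for which all the norms `‖·‖ₙ` are
continuous, with its uniform structure. -/
@[reducible] def projUniformSpace : UniformSpace D :=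
  ⨅ n, UniformSpace.comap (PreScale.of X n) inferInstance

variable [CompleteSpace H]

/-- The map `Hₙ → H` that extends the inclusion of `D` in `H`. -/
def HilbertScale.toHilbert (n : ℕ) : HilbertScale X n →L[ℂ] H :=
  ContinuousLinearMap.fromCompletion
    (LinearMap.mkContinuous (D.subtype ∘ₗ (PreScale.of X n).symm.toLinearMap) 1 fun φ => by
      simpa using PreScale.norm_le_norm_of X n ((PreScale.of X n).symm φ))

lemma HilbertScale.toHilbert_coe (n : ℕ) (φ : D) :
    HilbertScale.toHilbert X n (HilbertScale.coe X n (PreScale.of X n φ)) = φ :=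
  ContinuousLinearMap.fromCompletion_apply_coe _ (PreScale.of X n φ)

/-- The map `Φ → H`. -/
def ProjLimit.toHilbert : ProjLimit X →L[ℂ] H :=
  (HilbertScale.toHilbert X 0).comp
    ((ContinuousLinearMap.proj (R := ℂ) (φ := fun n => HilbertScale X n) 0).comp
      (ProjLimit X).subtypeL)

end Scale

/-! ### The differential of a representation, and invariant domains -/

section Differential

variable {E : Type*} [NormedAddCommGroup E] [NormedSpace ℝ E]
  {G : Type*} [TopologicalSpace G] [ChartedSpace E G] [Group G]
  {H : Type*} [NormedAddCommGroup H] [InnerProductSpace ℂ H]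

variable (E) in
/-- The differential of `T` at the identity: `repDifferential E T x φ` is the derivative at `1`,
in the direction `x`, of the orbit map `g ↦ T g φ`. -/
def repDifferential (T : Representation ℂ G H) (x : GroupLieAlgebra 𝓘(ℝ, E) G) (φ : H) : H :=
  mfderiv 𝓘(ℝ, E) 𝓘(ℝ, H) (fun g : G => T g φ) 1 x

variable (E) in
/-- A dense subspace `D` of `H`, contained in the domain of the differential of `T`, that is
invariant under `T` and under its differential. -/
structure IsInvariantDomain (T : Representation ℂ G H) (D : Submodule ℂ H) : Prop where
  dense : Dense (D : Set H)
  rep_mem : ∀ g : G, ∀ φ ∈ D, T g φ ∈ D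
  differentiable : ∀ φ ∈ D, MDifferentiableAt 𝓘(ℝ, E) 𝓘(ℝ, H) (fun g : G => T g φ) 1
  differential_mem : ∀ x : GroupLieAlgebra 𝓘(ℝ, E) G, ∀ φ ∈ D, repDifferential E T x φ ∈ D

variable {T : Representation ℂ G H} {D : Submodule ℂ H}

lemma repDifferential_add (x : GroupLieAlgebra 𝓘(ℝ, E) G) {φ ψ : H}
    (hφ : MDifferentiableAt 𝓘(ℝ, E) 𝓘(ℝ, H) (fun g : G => T g φ) 1)
    (hψ : MDifferentiableAt 𝓘(ℝ, E) 𝓘(ℝ, H) (fun g : G => T g ψ) 1) :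
    repDifferential E T x (φ + ψ) = repDifferential E T x φ + repDifferential E T x ψ := by
  have h : (fun g : G => T g (φ + ψ)) = (fun g : G => T g φ) + fun g : G => T g ψ := by
    funext g; simp
  unfold repDifferential
  rw [h]
  exact congrArg (fun L => L x) (hφ.hasMFDerivAt.add hψ.hasMFDerivAt).mfderiv

lemma repDifferential_smul (x : GroupLieAlgebra 𝓘(ℝ, E) G) (c : ℂ) {φ : H}
    (hφ : MDifferentiableAt 𝓘(ℝ, E) 𝓘(ℝ, H) (fun g : G => T g φ) 1) :
    repDifferential E T x (c • φ) = c • repDifferential E T x φ := by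
  let L : H →L[ℝ] H := c • ContinuousLinearMap.id ℝ H
  have h : (fun g : G => T g (c • φ)) = L ∘ fun g : G => T g φ := by
    funext g; simp [L]
  have hL : HasMFDerivAt 𝓘(ℝ, H) 𝓘(ℝ, H) L (T 1 φ) L := L.hasMFDerivAt
  have h' : HasMFDerivAt 𝓘(ℝ, E) 𝓘(ℝ, H) (L ∘ fun g : G => T g φ) 1
      (L.comp (mfderiv 𝓘(ℝ, E) 𝓘(ℝ, H) (fun g : G => T g φ) 1)) :=
    HasMFDerivAt.comp (1 : G) hL hφ.hasMFDerivAt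
  unfold repDifferential
  rw [h]
  exact congrArg (fun L => L x) h'.mfderiv

/-- The restriction to `D` of the differential of `T` in the direction `x`. -/
def IsInvariantDomain.operator (hD : IsInvariantDomain E T D)
    (x : GroupLieAlgebra 𝓘(ℝ, E) G) : D →ₗ[ℂ] D where
  toFun φ := ⟨repDifferential E T x φ, hD.differential_mem x φ φ.2⟩
  map_add' φ ψ := Subtype.ext
    (repDifferential_add x (hD.differentiable φ φ.2) (hD.differentiable ψ ψ.2))
  map_smul' c φ := Subtype.ext (repDifferential_smul x c (hD.differentiable φ φ.2))

end Differential

end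

/-!
The differential of `T` is controlled through three facts about an invariant domain `D` with a
basis `xᵢ` of the Lie algebra and `Xᵢ = T(xᵢ)`.

* Conjugation: `Xᵢ T(g) = ∑ⱼ aᵢⱼ(g) T(g) Xⱼ` on `D`, where `a(g)` is the matrix of `Ad g⁻¹`, which
  is continuous in `g` (`IsInvariantDomain.operator_rep`).
* Flow lines: along a local integral curve `c` of a left-invariant vector field, or along a
  one-parameter subgroup, `(T(c s) φ)' = T(c s) T(x) φ` for `φ ∈ D`
  (`IsInvariantDomain.exists_isFlowLine`).
* Mean value inequality in a chart: `‖T(g) φ - T(g₀) φ‖ ≤ r(g) ‖φ‖₁` with `r(g) → 0` as `g → g₀`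
  (`IsInvariantDomain.exists_norm_sub_le`).

They are collected in `IsScaleRep`, and the rest is functional analysis. Integrated, the flow
equation extends to `T(c t) f - f = ∫₀ᵗ T(c s) X f ds` in `H` for all `f ∈ Hₙ₊₁`. If `f` vanishes in
`H`, differentiating at `0` shows that `X f` vanishes too, which is the closability that makes the
maps `Hₙ → H` injective. The conjugation relation propagates two estimates from each norm to the
next: local boundedness of `T(g)` for `‖·‖ₙ`, and norm continuity of `g ↦ T(g)` as an operator from
`‖·‖ₙ₊₁` to `‖·‖ₙ`. Together they give a continuous representation on each `Hₙ`, hence on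
the projective limit `Φ`. By injectivity the integral formula holds in `Hₙ`, so the difference
quotients along a one-parameter subgroup differ from the generator by a mean of
`(T(γ s) - 1) X f`; norm continuity makes this small uniformly on bounded sets of `Φ`
(`IsScaleRep.norm_diffQuotient_sub_gen_le`), as the strong topology of the dual requires.

`Φ` is a Fréchet space, so it is barrelled: the Banach-Steinhaus theorem gives the sequential
completeness of the weak* dual and the sequential continuity of the dual representation. A
continuous functional on `Φ` is bounded for one of the norms, and the strong dual is complete since
`Φ` is first countable. Weak* density of `H` in the dual is finite interpolation by the Riesz
representation theorem.
-/

noncomputable section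

/-! ### Operators on the Hilbert scale -/

section Scale

variable {H : Type*} [NormedAddCommGroup H] [InnerProductSpace ℂ H] {D : Submodule ℂ H}
  {ι : Type*} [Fintype ι] (X : ι → D →ₗ[ℂ] D)

namespace PreScale

variable (n : ℕ)

lemma norm_of_op_le (i : ι) (φ : D) : ‖of X n (X i φ)‖ ≤ ‖of X (n + 1) φ‖ := by
  refine (sq_le_sq₀ (norm_nonneg _) (norm_nonneg _)).1 ?_
  rw [norm_sq_of_succ]
  have := Finset.single_le_sum (f := fun i => ‖of X n (X i φ)‖ ^ 2) (fun i _ => sq_nonneg _)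
    (Finset.mem_univ i)
  nlinarith [sq_nonneg ‖of X n φ‖]

lemma norm_of_succ_le (φ : D) :
    ‖of X (n + 1) φ‖ ≤ ∑ i, ‖of X n (X i φ)‖ + ‖of X n φ‖ := by
  have h0 : 0 ≤ ∑ i, ‖of X n (X i φ)‖ := Finset.sum_nonneg fun i _ => norm_nonneg _
  refine (sq_le_sq₀ (norm_nonneg _) (add_nonneg h0 (norm_nonneg _))).1 ?_
  rw [norm_sq_of_succ, add_sq]
  have h1 : ∑ i, ‖of X n (X i φ)‖ ^ 2 ≤ (∑ i, ‖of X n (X i φ)‖) ^ 2 :=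
    Finset.sum_sq_le_sq_sum_of_nonneg fun i _ => norm_nonneg _
  nlinarith [mul_nonneg h0 (norm_nonneg (of X n φ))]

end PreScale

namespace HilbertScale

/-- The canonical map `D → Hₙ`. -/
def ofDomain (n : ℕ) : D →ₗ[ℂ] HilbertScale X n :=
  (coe X n).toLinearMap ∘ₗ (PreScale.of X n).toLinearMap

lemma norm_ofDomain (n : ℕ) (φ : D) : ‖ofDomain X n φ‖ = ‖PreScale.of X n φ‖ :=
  norm_coe X n _

lemma denseRange_ofDomain (n : ℕ) : DenseRange (ofDomain X n) := by
  have h := (denseRange_coe X n).comp (PreScale.of X n).surjective.denseRange (coe X n).continuous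
  exact h

lemma step_ofDomain (n : ℕ) (φ : D) : step X n (ofDomain X (n + 1) φ) = ofDomain X n φ :=
  step_coe X n φ

variable {X}

/-- Continuous maps that agree on `D` agree on `Hₙ`. -/
lemma eq_of_forall_ofDomain {n : ℕ} {Y : Type*} [TopologicalSpace Y] [T2Space Y]
    {f g : HilbertScale X n → Y} (hf : Continuous f) (hg : Continuous g)
    (h : ∀ φ, f (ofDomain X n φ) = g (ofDomain X n φ)) (x : HilbertScale X n) : f x = g x :=
  congrFun ((denseRange_ofDomain X n).equalizer hf hg (funext h)) x

/-- Inequalities between continuous functions on `Hₙ` may be checked on `D`. -/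
lemma le_of_forall_ofDomain {n : ℕ} {f g : HilbertScale X n → ℝ} (hf : Continuous f)
    (hg : Continuous g) (h : ∀ φ, f (ofDomain X n φ) ≤ g (ofDomain X n φ))
    (x : HilbertScale X n) : f x ≤ g x :=
  (denseRange_ofDomain X n).induction_on x (isClosed_le hf hg) h

/-- The continuous extension `Hₘ → Hₙ` of a linear operator on `D` that is bounded from the
norm `‖·‖ₘ` to the norm `‖·‖ₙ`. -/
def extend {m n : ℕ} (L : D →ₗ[ℂ] D) (C : ℝ)
    (h : ∀ φ, ‖PreScale.of X n (L φ)‖ ≤ C * ‖PreScale.of X m φ‖) :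
    HilbertScale X m →L[ℂ] HilbertScale X n :=
  (LinearMap.mkContinuous
    ((PreScale.of X n).toLinearMap ∘ₗ L ∘ₗ (PreScale.of X m).symm.toLinearMap) C
    fun φ => h ((PreScale.of X m).symm φ)).completion

lemma extend_ofDomain {m n : ℕ} (L : D →ₗ[ℂ] D) (C : ℝ)
    (h : ∀ φ, ‖PreScale.of X n (L φ)‖ ≤ C * ‖PreScale.of X m φ‖) (φ : D) :
    extend L C h (ofDomain X m φ) = ofDomain X n (L φ) :=
  ContinuousLinearMap.completion_apply_coe _ (PreScale.of X m φ)

variable (X)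

/-- The continuous extension `Hₙ₊₁ → Hₙ` of `Xᵢ`. -/
def op (n : ℕ) (i : ι) : HilbertScale X (n + 1) →L[ℂ] HilbertScale X n :=
  extend (X i) 1 fun φ => by simpa using PreScale.norm_of_op_le X n i φ

lemma op_ofDomain (n : ℕ) (i : ι) (φ : D) :
    op X n i (ofDomain X (n + 1) φ) = ofDomain X n (X i φ) :=
  extend_ofDomain _ _ _ φ

lemma norm_sq_succ (n : ℕ) (f : HilbertScale X (n + 1)) :
    ‖f‖ ^ 2 = ∑ i, ‖op X n i f‖ ^ 2 + ‖step X n f‖ ^ 2 := by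
  refine eq_of_forall_ofDomain (f := fun f : HilbertScale X (n + 1) => ‖f‖ ^ 2)
    (g := fun f => ∑ i, ‖op X n i f‖ ^ 2 + ‖step X n f‖ ^ 2)
    (by fun_prop) (by fun_prop) (fun φ => ?_) f
  simp only [op_ofDomain, step_ofDomain, norm_ofDomain]
  exact PreScale.norm_sq_of_succ X n φ

lemma step_op (n : ℕ) (i : ι) (f : HilbertScale X (n + 2)) :
    step X n (op X (n + 1) i f) = op X n i (step X (n + 1) f) :=
  eq_of_forall_ofDomain (f := fun f => step X n (op X (n + 1) i f))
    (g := fun f => op X n i (step X (n + 1) f)) (by fun_prop) (by fun_prop)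
    (fun φ => by simp only [op_ofDomain, step_ofDomain]) f

lemma norm_step_le (n : ℕ) (f : HilbertScale X (n + 1)) : ‖step X n f‖ ≤ ‖f‖ := by
  refine (sq_le_sq₀ (norm_nonneg _) (norm_nonneg _)).1 ?_
  rw [norm_sq_succ X n f]
  exact le_add_of_nonneg_left (Finset.sum_nonneg fun i _ => sq_nonneg _)

variable [CompleteSpace H]

lemma toHilbert_ofDomain (n : ℕ) (φ : D) : toHilbert X n (ofDomain X n φ) = φ :=
  toHilbert_coe X n φ

lemma toHilbert_step (n : ℕ) (f : HilbertScale X (n + 1)) :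
    toHilbert X n (step X n f) = toHilbert X (n + 1) f :=
  eq_of_forall_ofDomain (f := fun f => toHilbert X n (step X n f)) (g := toHilbert X (n + 1))
    (by fun_prop) (by fun_prop)
    (fun φ => by simp only [step_ofDomain, toHilbert_ofDomain]) f

lemma norm_toHilbert_zero (f : HilbertScale X 0) : ‖toHilbert X 0 f‖ = ‖f‖ :=
  eq_of_forall_ofDomain (f := fun f => ‖toHilbert X 0 f‖) (g := fun f => ‖f‖)
    (by fun_prop) (by fun_prop)
    (fun φ => by
      rw [toHilbert_ofDomain, norm_ofDomain, PreScale.norm_of_zero, Submodule.coe_norm]) f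

/-- If the operators `Xᵢ` are closable, in the sense that `Xᵢ f` vanishes in `H` for every
`f ∈ Hₙ₊₁` that vanishes in `H`, then the maps `Hₙ → H` are injective. -/
lemma injective_toHilbert
    (hcl : ∀ n (f : HilbertScale X (n + 1)), toHilbert X (n + 1) f = 0 →
      ∀ i, toHilbert X n (op X n i f) = 0) (n : ℕ) :
    Function.Injective (toHilbert X n) := by
  induction n with
  | zero =>
    refine (injective_iff_map_eq_zero _).2 fun f hf => ?_
    rw [← norm_eq_zero, ← norm_toHilbert_zero, hf, norm_zero]
  | succ n ih =>
    refine (injective_iff_map_eq_zero _).2 fun f hf => ?_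
    have h1 : ∀ i, op X n i f = 0 := fun i =>
      (injective_iff_map_eq_zero _).1 ih _ (hcl n f hf i)
    have h2 : step X n f = 0 :=
      (injective_iff_map_eq_zero _).1 ih _ (by rw [toHilbert_step, hf])
    have h3 := norm_sq_succ X n f
    simp only [h1, h2, norm_zero] at h3
    simpa using h3

end HilbertScale

/-! ### The topology of the projective limit -/

namespace ProjLimit

/-- The projection `Φ → Hₙ`. -/
def proj (n : ℕ) : ProjLimit X →L[ℂ] HilbertScale X n :=
  (ContinuousLinearMap.proj (R := ℂ) (φ := fun n => HilbertScale X n) n).comp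
    (ProjLimit X).subtypeL

variable {X}

lemma step_proj (n : ℕ) (f : ProjLimit X) :
    HilbertScale.step X n (proj X (n + 1) f) = proj X n f := f.2 n

lemma ext_proj {f g : ProjLimit X} (h : ∀ n, proj X n f = proj X n g) : f = g :=
  Subtype.ext (funext h)

lemma continuous_iff_proj {Y : Type*} [TopologicalSpace Y] {u : Y → ProjLimit X} :
    Continuous u ↔ ∀ n, Continuous fun y => proj X n (u y) := by
  rw [continuous_induced_rng, continuous_pi_iff]; rfl

lemma tendsto_iff_proj {Y : Type*} {l : Filter Y} {u : Y → ProjLimit X} {f : ProjLimit X} :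
    Tendsto u l (𝓝 f) ↔ ∀ n, Tendsto (fun y => proj X n (u y)) l (𝓝 (proj X n f)) := by
  rw [tendsto_subtype_rng, tendsto_pi_nhds]; rfl

lemma norm_proj_mono (f : ProjLimit X) : Monotone fun n => ‖proj X n f‖ :=
  monotone_nat_of_le_succ fun n => by
    rw [← step_proj]; exact HilbertScale.norm_step_le X n _

/-- The norms increase, so the balls of a single norm form a neighbourhood basis of zero. -/
lemma exists_ball_subset_of_mem_nhds_zero {U : Set (ProjLimit X)} (hU : U ∈ 𝓝 0) :
    ∃ n, ∃ ε > 0, {f : ProjLimit X | ‖proj X n f‖ < ε} ⊆ U := by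
  rw [nhds_subtype_eq_comap, mem_comap] at hU
  obtain ⟨V, hV, hVU⟩ := hU
  rw [nhds_pi, Filter.mem_pi] at hV
  obtain ⟨I, hI, t, ht, htV⟩ := hV
  have h1 : ∀ n, ∃ ε > 0, Metric.ball (0 : HilbertScale X n) ε ⊆ t n := fun n =>
    Metric.mem_nhds_iff.1 (ht n)
  choose ε hε hεt using h1
  obtain ⟨N, hN⟩ := hI.bddAbove
  refine ⟨N, (hI.toFinset.image ε ∪ {1}).min' (by simp), ?_, ?_⟩
  · have := Finset.min'_mem (hI.toFinset.image ε ∪ {1}) (by simp)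
    rw [Finset.mem_union, Finset.mem_image, Finset.mem_singleton] at this
    rcases this with ⟨i, -, hi⟩ | h
    · exact hi ▸ hε i
    · rw [h]; exact one_pos
  · intro f hf
    refine hVU (htV fun i hi => hεt i ?_)
    rw [mem_ball_zero_iff]
    refine ((norm_proj_mono f (hN hi)).trans_lt hf).trans_le (Finset.min'_le _ _ ?_)
    exact Finset.mem_union_left _ (Finset.mem_image_of_mem _ (hI.mem_toFinset.2 hi))

lemma isVonNBounded_iff {B : Set (ProjLimit X)} :
    Bornology.IsVonNBounded ℂ B ↔ ∀ n, ∃ R, ∀ f ∈ B, ‖proj X n f‖ ≤ R := by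
  constructor
  · intro hB n
    have h := NormedSpace.isVonNBounded_iff ℂ |>.1 (hB.image (proj X n))
    obtain ⟨R, hR⟩ := isBounded_iff_forall_norm_le.1 h
    exact ⟨R, fun f hf => hR _ (mem_image_of_mem _ hf)⟩
  · intro h U hU
    obtain ⟨n, ε, hε, hU⟩ := exists_ball_subset_of_mem_nhds_zero hU
    obtain ⟨R, hR⟩ := h n
    refine absorbs_iff_norm.2 ⟨(|R| + 1) / ε, fun c hc f hf => ?_⟩
    have hc0 : 0 < ‖c‖ := lt_of_lt_of_le (by positivity) hc
    rw [mem_smul_set_iff_inv_smul_mem₀ (norm_pos_iff.1 hc0)]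
    refine hU ?_
    change ‖proj X n (c⁻¹ • f)‖ < ε
    rw [map_smul, norm_smul, norm_inv, inv_mul_lt_iff₀ hc0]
    rw [div_le_iff₀ hε] at hc
    linarith [hR f hf, le_abs_self R]

/-- A continuous antilinear functional on `Φ` is bounded for one of the norms. -/
lemma exists_norm_apply_le (F : ProjLimit X →L⋆[ℂ] ℂ) :
    ∃ n, ∃ C, 0 ≤ C ∧ ∀ f, ‖F f‖ ≤ C * ‖proj X n f‖ := by
  have hU : {f : ProjLimit X | ‖F f‖ < 1} ∈ 𝓝 0 :=
    (isOpen_lt F.continuous.norm continuous_const).mem_nhds (by simp)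
  obtain ⟨n, ε, hε, hU⟩ := exists_ball_subset_of_mem_nhds_zero hU
  refine ⟨n, 2 / ε, by positivity, fun f => ?_⟩
  -- the vector `r⁻¹ • f` has norm less than `ε` whenever `r > ‖f‖ / ε`
  refine le_of_forall_gt_imp_ge_of_dense fun s hs => ?_
  have hs0 : 0 < s := lt_of_le_of_lt (by positivity) hs
  have h1 : ‖F (((s⁻¹ : ℝ) : ℂ) • f)‖ < 1 := by
    refine hU ?_
    change ‖proj X n (((s⁻¹ : ℝ) : ℂ) • f)‖ < ε
    rw [map_smul, norm_smul, Complex.norm_real, norm_inv, Real.norm_eq_abs,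
      abs_of_pos hs0, inv_mul_lt_iff₀ hs0]
    rw [div_mul_eq_mul_div, div_lt_iff₀ hε] at hs
    linarith [norm_nonneg (proj X n f)]
  rw [map_smulₛₗ, norm_smul, RCLike.norm_conj, Complex.norm_real, norm_inv, Real.norm_eq_abs,
    abs_of_pos hs0, inv_mul_lt_iff₀ hs0, mul_one] at h1
  exact h1.le

instance : CompleteSpace (ProjLimit X) := by
  have h : IsClosed (ProjLimit X : Set (∀ n, HilbertScale X n)) := by
    have : (ProjLimit X : Set (∀ n, HilbertScale X n)) =
        ⋂ n, {f | HilbertScale.step X n (f (n + 1)) = f n} := by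
      ext f; simp [ProjLimit]
    rw [this]
    exact isClosed_iInter fun n => isClosed_eq (by fun_prop) (by fun_prop)
  exact h.completeSpace_coe

instance : LocallyConvexSpace ℝ (ProjLimit X) := by
  have : LocallyConvexSpace ℝ (∀ n, HilbertScale X n) := inferInstance
  exact Topology.IsInducing.locallyConvexSpace (f := ((ProjLimit X).subtype.restrictScalars ℝ))
    IsInducing.subtypeVal

instance : (uniformity (ProjLimit X)).IsCountablyGenerated := by
  rw [uniformity_subtype]; infer_instance

variable (X)

/-- The canonical map `D → Φ`. -/
def ofDomain (φ : D) : ProjLimit X :=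
  ⟨fun n => HilbertScale.ofDomain X n φ, fun n => HilbertScale.step_ofDomain X n φ⟩

variable [CompleteSpace H]

lemma toHilbert_proj (n : ℕ) (f : ProjLimit X) :
    HilbertScale.toHilbert X n (proj X n f) = toHilbert X f := by
  induction n with
  | zero => rfl
  | succ n ih => rw [← ih, ← step_proj n, HilbertScale.toHilbert_step]

lemma toHilbert_ofDomain (φ : D) : toHilbert X (ofDomain X φ) = φ :=
  HilbertScale.toHilbert_ofDomain X 0 φ

lemma injective_toHilbert (hinj : ∀ n, Function.Injective (HilbertScale.toHilbert X n)) :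
    Function.Injective (toHilbert X) := fun f g h =>
  ext_proj fun n => hinj n (by rw [toHilbert_proj, toHilbert_proj, h])

lemma range_toHilbert (hinj : ∀ n, Function.Injective (HilbertScale.toHilbert X n)) :
    range (toHilbert X) = ⋂ n, range (HilbertScale.toHilbert X n) := by
  ext h
  simp only [mem_iInter, mem_range]
  constructor
  · rintro ⟨f, rfl⟩ n
    exact ⟨proj X n f, toHilbert_proj X n f⟩
  · intro hh
    choose f hf using hh
    refine ⟨⟨f, fun n => hinj n ?_⟩, hf 0⟩
    rw [HilbertScale.toHilbert_step, hf, hf]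

end ProjLimit

end Scale

/-! ### Continuous representations -/

section ContinuousRep

variable {G Ψ : Type*} [TopologicalSpace G] [Group G] [AddCommGroup Ψ] [Module ℂ Ψ]
  [TopologicalSpace Ψ] {T : Representation ℂ G Ψ}

/-- The operators of a continuous representation, as continuous operators. -/
def IsContinuousRep.toCLM (hT : IsContinuousRep T) (g : G) : Ψ →L[ℂ] Ψ where
  toLinearMap := T g
  cont := Continuous.comp (g := fun p : G × Ψ => T p.1 p.2) hT (Continuous.prodMk_right g)

lemma IsContinuousRep.continuous_comp (hT : IsContinuousRep T) {Y : Type*} [TopologicalSpace Y]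
    {u : Y → G} {v : Y → Ψ} (hu : Continuous u) (hv : Continuous v) :
    Continuous fun y => T (u y) (v y) :=
  Continuous.comp (g := fun p : G × Ψ => T p.1 p.2) hT (hu.prodMk hv)

end ContinuousRep

/-! ### Orbit maps of a representation of a Lie group -/

section Orbits

variable {E : Type*} [NormedAddCommGroup E] [NormedSpace ℝ E]
  {G : Type*} [TopologicalSpace G] [ChartedSpace E G] [Group G]
  {H : Type*} [NormedAddCommGroup H] [InnerProductSpace ℂ H]
  {T : Representation ℂ G H} {D : Submodule ℂ H}

lemma IsContinuousRep.exists_norm_le {G : Type*} [TopologicalSpace G] [Group G]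
    {T : Representation ℂ G H} (hT : IsContinuousRep T) (g₀ : G) :
    ∃ C, 0 ≤ C ∧ ∀ᶠ g in 𝓝 g₀, ∀ φ, ‖T g φ‖ ≤ C * ‖φ‖ := by
  have h0 : Tendsto (fun p : G × H => T p.1 p.2) (𝓝 (g₀, 0)) (𝓝 0) := by
    simpa using (Continuous.tendsto hT (g₀, (0 : H)))
  have h1 := h0 (Metric.ball_mem_nhds 0 one_pos)
  rw [nhds_prod_eq, mem_map, mem_prod_iff] at h1
  obtain ⟨U, hU, V, hV, hUV⟩ := h1
  obtain ⟨δ, hδ, hδV⟩ := Metric.mem_nhds_iff.1 hV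
  refine ⟨2 / δ, by positivity, ?_⟩
  filter_upwards [hU] with g hg φ
  rcases eq_or_ne φ 0 with rfl | hφ
  · simp
  have hφ' : 0 < ‖φ‖ := norm_pos_iff.2 hφ
  set c : ℝ := δ / (2 * ‖φ‖)
  have hc : 0 < c := by positivity
  have h2 : ‖T g ((c : ℂ) • φ)‖ < 1 := by
    have h3 : (c : ℂ) • φ ∈ V := hδV (by
      rw [mem_ball_zero_iff, norm_smul, Complex.norm_real, Real.norm_eq_abs, abs_of_pos hc]
      have : c * ‖φ‖ = δ / 2 := by simp only [c]; field_simp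
      linarith)
    have h4 : (g, (c : ℂ) • φ) ∈ U ×ˢ V := ⟨hg, h3⟩
    simpa using hUV h4
  rw [map_smul, norm_smul, Complex.norm_real, Real.norm_eq_abs, abs_of_pos hc] at h2
  have h5 : ‖T g φ‖ < 1 / c := by rwa [lt_div_iff₀' hc]
  refine h5.le.trans (le_of_eq ?_)
  simp only [c]; field_simp

/-- If `y ↦ (c m)⁻¹ * c y` has derivative `c'` at `m`, then `y ↦ T (c y) φ` has derivative
`T (c m) ∘ d(orbit map of φ at 1) ∘ c'` at `m`, since
`T (c y) φ = T (c m) (T ((c m)⁻¹ * c y) φ)`. -/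
lemma IsContinuousRep.hasMFDerivAt_orbit_comp (hT : IsContinuousRep T) {φ : H}
    (hφ : MDifferentiableAt 𝓘(ℝ, E) 𝓘(ℝ, H) (fun g : G => T g φ) 1)
    {F : Type*} [NormedAddCommGroup F] [NormedSpace ℝ F] {M : Type*} [TopologicalSpace M]
    [ChartedSpace F M] {c : M → G} {m : M} {c' : F →L[ℝ] E}
    (hc : HasMFDerivAt 𝓘(ℝ, F) 𝓘(ℝ, E) (fun y => (c m)⁻¹ * c y) m c') :
    HasMFDerivAt 𝓘(ℝ, F) 𝓘(ℝ, H) (fun y => T (c y) φ) m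
      (((hT.toCLM (c m)).restrictScalars ℝ).comp
        ((mfderiv 𝓘(ℝ, E) 𝓘(ℝ, H) (fun g : G => T g φ) 1 : E →L[ℝ] H).comp c') : F →L[ℝ] H) := by
  have h1 : HasMFDerivAt 𝓘(ℝ, E) 𝓘(ℝ, H) (fun g : G => T g φ) ((c m)⁻¹ * c m)
      (mfderiv 𝓘(ℝ, E) 𝓘(ℝ, H) (fun g : G => T g φ) 1 : E →L[ℝ] H) := by
    rw [inv_mul_cancel]; exact hφ.hasMFDerivAt
  have h2 := HasMFDerivAt.comp m h1 hc
  have h3 := HasMFDerivAt.comp m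
    (((hT.toCLM (c m)).restrictScalars ℝ).hasMFDerivAt (x := T ((c m)⁻¹ * c m) φ)) h2
  refine h3.congr_of_eventuallyEq (Eventually.of_forall fun y => ?_)
  change T (c y) φ = T (c m) (T ((c m)⁻¹ * c y) φ)
  rw [← Module.End.mul_apply, ← map_mul, mul_inv_cancel_left]

section LieGroup

variable [LieGroup 𝓘(ℝ, E) ∞ G]

/-- The differential at `1` of `h ↦ g⁻¹ * h * g`, that is, `Ad g⁻¹`. -/
def adjointInv (g : G) : E →L[ℝ] E :=
  mfderiv 𝓘(ℝ, E) 𝓘(ℝ, E) (fun h : G => g⁻¹ * h * g) 1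

/-- A smooth family of maps to `G`, all equal to `1` at the base point, has continuous derivative
there. -/
lemma continuousAt_mfderiv_of_eq_one {F₁ F₂ : Type*} [NormedAddCommGroup F₁] [NormedSpace ℝ F₁]
    [NormedAddCommGroup F₂] [NormedSpace ℝ F₂] {N M : Type*} [TopologicalSpace N]
    [ChartedSpace F₁ N] [TopologicalSpace M] [ChartedSpace F₂ M] [IsManifold 𝓘(ℝ, F₁) 1 N]
    [IsManifold 𝓘(ℝ, F₂) 1 M] {f : N → M → G} {p : N → M} {x₀ : N}
    (hf : ContMDiffAt (𝓘(ℝ, F₁).prod 𝓘(ℝ, F₂)) 𝓘(ℝ, E) ∞ (Function.uncurry f) (x₀, p x₀))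
    (hp : ContMDiffAt 𝓘(ℝ, F₁) 𝓘(ℝ, F₂) ∞ p x₀) (hfp : ∀ᶠ x in 𝓝 x₀, f x (p x) = 1)
    (hchart : ∀ x, achart F₂ (p x) = achart F₂ (p x₀)) :
    ContinuousAt (Y := F₂ →L[ℝ] E) (fun x => mfderiv 𝓘(ℝ, F₂) 𝓘(ℝ, E) (f x) (p x)) x₀ := by
  have : IsManifold 𝓘(ℝ, E) 1 G := IsManifold.of_le (n := ∞) (by simp)
  have h := (ContMDiffAt.mfderiv (m := 0) (n := ∞) f p hf (hp.of_le (by simp))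
    (by simp)).continuousAt
  refine h.congr ?_
  filter_upwards [hfp] with x hx
  have hx₀ := hfp.self_of_nhds
  have hsrc : p x ∈ (chartAt F₂ (p x₀)).source := by
    have := congrArg Subtype.val (hchart x)
    simp only [coe_achart] at this
    rw [← this]; exact mem_chart_source F₂ (p x)
  have hsrc' : f x (p x) ∈ (chartAt E (f x₀ (p x₀))).source := by
    rw [hx, hx₀]; exact mem_chart_source E 1
  let L : N → F₂ →L[ℝ] E := fun x => mfderiv 𝓘(ℝ, F₂) 𝓘(ℝ, E) (f x) (p x)
  refine (inTangentCoordinates_eq (I := 𝓘(ℝ, F₂)) (I' := 𝓘(ℝ, E)) p (fun x => f x (p x)) L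
    hsrc hsrc').trans ?_
  change _ = L x
  rw [hchart x, hx, hx₀]
  ext v
  have e1 := (tangentBundleCore 𝓘(ℝ, F₂) M).coordChange_self (achart F₂ (p x₀)) (p x) hsrc v
  have e2 := (tangentBundleCore 𝓘(ℝ, E) G).coordChange_self (achart E 1) 1
    (mem_chart_source E 1) (L x v)
  rw [ContinuousLinearMap.comp_apply, ContinuousLinearMap.comp_apply, e1, e2]

lemma continuous_adjointInv : Continuous (adjointInv (E := E) : G → E →L[ℝ] E) := by
  have : IsManifold 𝓘(ℝ, E) 1 G := IsManifold.of_le (n := ∞) (by simp)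
  refine continuous_iff_continuousAt.2 fun g₀ => ?_
  refine continuousAt_mfderiv_of_eq_one (F₁ := E) (F₂ := E)
    (f := fun g h : G => g⁻¹ * h * g) (p := fun _ => 1)
    ?_ contMDiffAt_const (Eventually.of_forall fun g => by simp) fun _ => rfl
  refine ContMDiff.contMDiffAt ?_
  exact (contMDiff_fst.inv.mul contMDiff_snd).mul contMDiff_fst

end LieGroup

end Orbits

/-! ### The differential on an invariant domain -/

section Domain

variable {E : Type*} [NormedAddCommGroup E] [NormedSpace ℝ E]
  {G : Type*} [TopologicalSpace G] [ChartedSpace E G] [Group G]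
  {H : Type*} [NormedAddCommGroup H] [InnerProductSpace ℂ H]
  {T : Representation ℂ G H} {D : Submodule ℂ H}

/-- The operator `T g` on an invariant domain. -/
def IsInvariantDomain.rep (hD : IsInvariantDomain E T D) (g : G) : D →ₗ[ℂ] D :=
  (T g).restrict (hD.rep_mem g)

@[simp] lemma IsInvariantDomain.coe_rep (hD : IsInvariantDomain E T D) (g : G) (φ : D) :
    (hD.rep g φ : H) = T g φ := rfl

/-- A curve `c` through `1` along which the representation satisfies `(T (c s) φ)' = T (c s) (Y φ)`
for `φ ∈ D` and `|s| < δ`. -/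
structure IsFlowLine (T : Representation ℂ G H) (Y : D →ₗ[ℂ] D) (c : ℝ → G) (δ : ℝ) : Prop where
  pos : 0 < δ
  continuous : Continuous c
  map_zero : c 0 = 1
  hasDerivAt : ∀ s, |s| < δ → ∀ φ : D,
    HasDerivAt (fun s => T (c s) (φ : H)) (T (c s) (Y φ : H)) s

/-- Left translating the velocity of `c` to `1` gives the derivative of `T (c s) φ`. -/
lemma IsInvariantDomain.hasDerivAt_orbit (hD : IsInvariantDomain E T D) (hT : IsContinuousRep T)
    {c : ℝ → G} {s : ℝ} {x : GroupLieAlgebra 𝓘(ℝ, E) G}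
    (hc : HasMFDerivAt 𝓘(ℝ, ℝ) 𝓘(ℝ, E) (fun t => (c s)⁻¹ * c t) s
      ((1 : ℝ →L[ℝ] ℝ).smulRight (x : E))) (φ : D) :
    HasDerivAt (fun s => T (c s) (φ : H)) (T (c s) (hD.operator x φ : H)) s := by
  let u : E →L[ℝ] H := mfderiv 𝓘(ℝ, E) 𝓘(ℝ, H) (fun g : G => T g φ) 1
  have h : HasFDerivAt (fun s => T (c s) (φ : H)) (((hT.toCLM (c s)).restrictScalars ℝ).comp
      (u.comp ((1 : ℝ →L[ℝ] ℝ).smulRight (x : E)))) s :=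
    (hT.hasMFDerivAt_orbit_comp (hD.differentiable φ φ.2) hc).hasFDerivAt
  refine h.hasDerivAt.congr_deriv ?_
  change T (c s) (u ((1 : ℝ) • (x : E))) = T (c s) (u x)
  rw [one_smul]

/-- A one-parameter subgroup is a flow line in the direction of its velocity at `0`. -/
lemma IsInvariantDomain.exists_isFlowLine_of_isOneParameterSubgroup
    (hD : IsInvariantDomain E T D) (hT : IsContinuousRep T) {γ : ℝ → G}
    (hγ : IsOneParameterSubgroup E γ) :
    ∃ x : GroupLieAlgebra 𝓘(ℝ, E) G, ∀ δ > 0, IsFlowLine T (hD.operator x) γ δ := by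
  obtain ⟨hadd, hsmooth⟩ := hγ
  have h0 : γ 0 = 1 := by simpa using hadd 0 0
  let L : ℝ →L[ℝ] E := mfderiv 𝓘(ℝ, ℝ) 𝓘(ℝ, E) γ 0
  refine ⟨L 1, fun δ hδ => ⟨hδ, hsmooth.continuous, h0, fun s _ φ => ?_⟩⟩
  refine hD.hasDerivAt_orbit hT ?_ φ
  have h1 : (fun t => (γ s)⁻¹ * γ t) = γ ∘ fun t => t - s := by
    funext t
    rw [inv_mul_eq_iff_eq_mul, Function.comp_apply, ← hadd, add_sub_cancel]
  have h2 : HasMFDerivAt 𝓘(ℝ, ℝ) 𝓘(ℝ, E) γ (s - s) L := by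
    rw [sub_self]
    exact ((hsmooth 0).mdifferentiableAt (by simp)).hasMFDerivAt
  have h3 : HasMFDerivAt 𝓘(ℝ, ℝ) 𝓘(ℝ, ℝ) (fun t : ℝ => t - s) s (ContinuousLinearMap.id ℝ ℝ) :=
    ((hasFDerivAt_id s).sub_const s).hasMFDerivAt
  rw [h1]
  refine (HasMFDerivAt.comp (f := fun t : ℝ => t - s) s h2 h3).congr_mfderiv ?_
  refine ContinuousLinearMap.ext_ring ?_
  change L 1 = (1 : ℝ) • L 1
  rw [one_smul]

section Basis

variable {ι : Type*} [Fintype ι] (b : Module.Basis ι ℝ (GroupLieAlgebra 𝓘(ℝ, E) G))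

lemma IsInvariantDomain.operator_eq_sum (hD : IsInvariantDomain E T D)
    (x : GroupLieAlgebra 𝓘(ℝ, E) G) (φ : D) :
    hD.operator x φ = ∑ i, ((b.repr x i : ℝ) : ℂ) • hD.operator (b i) φ := by
  refine Subtype.ext ?_
  let u : E →L[ℝ] H := mfderiv 𝓘(ℝ, E) 𝓘(ℝ, H) (fun g : G => T g φ) 1
  let b' : Module.Basis ι ℝ E := b
  have h : u x = ∑ i, b'.repr x i • u (b' i) := by
    conv_lhs => rw [← b'.sum_repr x]
    simp only [map_sum, map_smul]
  rw [Submodule.coe_sum]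
  refine h.trans (Finset.sum_congr rfl fun i _ => ?_)
  exact (Complex.coe_smul _ _).symm

/-- The matrix entries of `Ad g⁻¹` in the basis `b`. -/
def adjointCoeff (g : G) (i j : ι) : ℝ := b.repr (adjointInv (E := E) g (b i)) j

lemma continuous_adjointCoeff {ι : Type*} (b : Module.Basis ι ℝ (GroupLieAlgebra 𝓘(ℝ, E) G))
    [LieGroup 𝓘(ℝ, E) ∞ G] [FiniteDimensional ℝ E] (i j : ι) :
    Continuous fun g : G => adjointCoeff b g i j := by
  let l : E →ₗ[ℝ] ℝ := b.coord j
  have h : Continuous fun g : G => adjointInv (E := E) g (b i : E) :=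
    (continuous_adjointInv (E := E) (G := G)).clm_apply continuous_const
  exact l.continuous_of_finiteDimensional.comp h

variable [LieGroup 𝓘(ℝ, E) ∞ G]

/-- `Xᵢ T(g) = T(g) T(Ad g⁻¹ xᵢ)`, expanded in the basis. -/
lemma IsInvariantDomain.operator_rep (hD : IsInvariantDomain E T D) (hT : IsContinuousRep T)
    (g : G) (i : ι) (φ : D) :
    hD.operator (b i) (hD.rep g φ) =
      ∑ j, (adjointCoeff b g i j : ℂ) • hD.rep g (hD.operator (b j) φ) := by
  have hc : HasMFDerivAt 𝓘(ℝ, E) 𝓘(ℝ, E) (fun h : G => ((1 : G) * g)⁻¹ * (h * g)) 1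
      (adjointInv (E := E) g) := by
    have h1 : (fun h : G => ((1 : G) * g)⁻¹ * (h * g)) = fun h => g⁻¹ * h * g := by
      funext h; rw [one_mul, mul_assoc]
    rw [h1]
    have h2 : ContMDiff 𝓘(ℝ, E) 𝓘(ℝ, E) ∞ fun h : G => g⁻¹ * h * g :=
      (contMDiff_const.mul contMDiff_id).mul contMDiff_const
    exact ((h2 1).mdifferentiableAt (by simp)).hasMFDerivAt
  have h := (hT.hasMFDerivAt_orbit_comp (c := fun h : G => h * g)
    (hD.differentiable φ φ.2) hc).mfderiv
  have h3 : (fun y : G => T (y * g) (φ : H)) = fun y => T y (hD.rep g φ : H) := by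
    funext y; rw [map_mul]; rfl
  rw [h3] at h
  let x : GroupLieAlgebra 𝓘(ℝ, E) G := adjointInv (E := E) g (b i)
  have h4 : hD.operator (b i) (hD.rep g φ) =
      hD.rep g (hD.operator x φ) := by
    refine Subtype.ext ((congrArg (fun L => L (b i)) h).trans ?_)
    change T (1 * g) _ = T g _
    rw [one_mul]; rfl
  rw [h4, hD.operator_eq_sum b, map_sum]
  refine Finset.sum_congr rfl fun j _ => ?_
  rw [map_smul]; rfl

/-- Through every direction of the Lie algebra there is a flow line: a local integral curve of the
left-invariant vector field, made constant outside an interval. -/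
lemma IsInvariantDomain.exists_isFlowLine [FiniteDimensional ℝ E] (hD : IsInvariantDomain E T D)
    (hT : IsContinuousRep T) (x : GroupLieAlgebra 𝓘(ℝ, E) G) :
    ∃ c δ, IsFlowLine T (hD.operator x) c δ := by
  have : CompleteSpace E := FiniteDimensional.complete ℝ E
  have : IsManifold 𝓘(ℝ, E) 1 G := IsManifold.of_le (n := ∞) (by simp)
  have : LieGroup 𝓘(ℝ, E) (minSmoothness ℝ 3) G := by
    rw [minSmoothness_of_isRCLikeNormedField]
    exact LieGroup.of_le (n := ∞) (WithTop.coe_le_coe.2 (le_top (a := (3 : ℕ∞))))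
  have hv := (contMDiff_mulInvariantVectorField x).contMDiffAt (x := (1 : G))
  obtain ⟨c, hc1, hc⟩ := exists_isMIntegralCurveAt_of_contMDiffAt_boundaryless (t₀ := 0)
    (hv.of_le (by rw [minSmoothness_of_isRCLikeNormedField]; norm_num))
  obtain ⟨δ, hδ, hball⟩ := Metric.eventually_nhds_iff.1 hc
  have hle : -(δ / 2) ≤ δ / 2 := by linarith
  have hcont : ContinuousOn c (Icc (-(δ / 2)) (δ / 2)) := fun s hs =>
    (hball (by rw [Real.dist_eq, sub_zero, abs_lt]; constructor <;>
      linarith [hs.1, hs.2])).continuousAt.continuousWithinAt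
  set c₁ : ℝ → G := IccExtend hle ((Icc (-(δ / 2)) (δ / 2)).domRestrict c) with hc₁
  have heq : ∀ s ∈ Icc (-(δ / 2)) (δ / 2), c₁ s = c s := fun s hs => by
    rw [hc₁, IccExtend_of_mem hle _ hs]; rfl
  refine ⟨c₁, δ / 2, by positivity, hcont.domRestrict.Icc_extend', ?_, fun s hs φ => ?_⟩
  · rw [heq 0 (by constructor <;> linarith), hc1]
  · rw [abs_lt] at hs
    have hs' : s ∈ Icc (-(δ / 2)) (δ / 2) := ⟨hs.1.le, hs.2.le⟩
    have h1 := hball (y := s) (by rw [Real.dist_eq, sub_zero, abs_lt]; constructor <;> linarith)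
    refine hD.hasDerivAt_orbit hT (c := c₁) ?_ φ
    have hmul : ∀ a h : G, MDifferentiableAt 𝓘(ℝ, E) 𝓘(ℝ, E) (fun y => a * y) h := fun a h =>
      ((contMDiff_mul_left (I := 𝓘(ℝ, E)) (n := ∞) (a := a)) h).mdifferentiableAt (by simp)
    have h2 := HasMFDerivAt.comp s (hmul (c s)⁻¹ (c s)).hasMFDerivAt h1
    have h3 := mfderiv_comp (I := 𝓘(ℝ, E)) (I' := 𝓘(ℝ, E)) (I'' := 𝓘(ℝ, E)) (1 : G)
      (hmul (c s)⁻¹ (c s * 1)) (hmul (c s) 1)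
    have h4 : ((fun y => (c s)⁻¹ * y) ∘ fun y => c s * y) = (id : G → G) := by
      funext y; simp
    rw [h4, mfderiv_id] at h3
    have h5 : (fun t => (c₁ s)⁻¹ * c₁ t) =ᶠ[𝓝 s] (fun y => (c s)⁻¹ * y) ∘ c := by
      filter_upwards [Icc_mem_nhds hs.1 hs.2] with t ht
      rw [heq s hs', heq t ht]; rfl
    refine (h2.congr_of_eventuallyEq h5).congr_mfderiv ?_
    have h6 : (mfderiv 𝓘(ℝ, E) 𝓘(ℝ, E) (fun y => (c s)⁻¹ * y) (c s) : E →L[ℝ] E)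
        (mfderiv 𝓘(ℝ, E) 𝓘(ℝ, E) (fun y => c s * y) 1 (x : E)) = x := by
      have h7 := congrArg (fun L : E →L[ℝ] E => L x) h3
      have h8 : ∀ q : G, q = c s →
          (mfderiv 𝓘(ℝ, E) 𝓘(ℝ, E) (fun y => (c s)⁻¹ * y) q : E →L[ℝ] E) =
            mfderiv 𝓘(ℝ, E) 𝓘(ℝ, E) (fun y => (c s)⁻¹ * y) (c s) := by
        rintro q rfl; rfl
      rw [← h8 _ (mul_one (c s))]
      exact h7.symm
    refine ContinuousLinearMap.ext_ring ?_
    change (mfderiv 𝓘(ℝ, E) 𝓘(ℝ, E) (fun y => (c s)⁻¹ * y) (c s) : E →L[ℝ] E)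
      ((1 : ℝ) • (mfderiv 𝓘(ℝ, E) 𝓘(ℝ, E) (fun y => c s * y) 1 (x : E) : E)) = (1 : ℝ) • (x : E)
    rw [one_smul, one_smul]
    exact h6

/-- The mean value inequality in a chart: near `g₀` the operators `T g - T g₀` are small, uniformly
on the vectors of `D` on which the `Xᵢ` are bounded. -/
lemma IsInvariantDomain.exists_norm_sub_le [FiniteDimensional ℝ E] (hD : IsInvariantDomain E T D)
    (hT : IsContinuousRep T) (g₀ : G) :
    ∃ r : G → ℝ, (∀ g, 0 ≤ r g) ∧ Tendsto r (𝓝 g₀) (𝓝 0) ∧ ∀ᶠ g in 𝓝 g₀, ∀ (φ : D) (M : ℝ), 0 ≤ M →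
      (∀ i, ‖(hD.operator (b i) φ : H)‖ ≤ M) → ‖T g (φ : H) - T g₀ (φ : H)‖ ≤ r g * M := by
  have : IsManifold 𝓘(ℝ, E) 1 G := IsManifold.of_le (n := ∞) (by simp)
  set e := extChartAt 𝓘(ℝ, E) g₀ with he
  set v₀ := e g₀ with hv₀
  have htarget : e.target ∈ 𝓝 v₀ := extChartAt_target_mem_nhds g₀
  have hsymm : ContMDiffOn 𝓘(ℝ, E) 𝓘(ℝ, E) ∞ e.symm e.target := contMDiffOn_extChartAt_symm g₀
  have hsymm₀ : ContMDiffAt 𝓘(ℝ, E) 𝓘(ℝ, E) ∞ e.symm v₀ := hsymm.contMDiffAt htarget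
  let A : E → E →L[ℝ] E := fun v =>
    mfderiv 𝓘(ℝ, E) 𝓘(ℝ, E) (fun w => (e.symm v)⁻¹ * e.symm w) v
  have hA : ContinuousAt A v₀ := by
    refine continuousAt_mfderiv_of_eq_one (F₁ := E) (F₂ := E)
      (f := fun v w : E => (e.symm v)⁻¹ * e.symm w) (p := fun v => v) ?_ contMDiffAt_id
      (Eventually.of_forall fun v => by simp) fun _ => rfl
    exact (ContMDiffAt.comp (v₀, v₀) hsymm₀ contMDiffAt_fst).inv.mul
      (ContMDiffAt.comp (v₀, v₀) hsymm₀ contMDiffAt_snd)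
  obtain ⟨C, hC, hTC⟩ := hT.exists_norm_le g₀
  have hTC' : ∀ᶠ v in 𝓝 v₀, ∀ φ, ‖T (e.symm v) φ‖ ≤ C * ‖φ‖ := by
    have : Tendsto e.symm (𝓝 v₀) (𝓝 g₀) := by
      have := hsymm₀.continuousAt.tendsto
      rwa [hv₀, extChartAt_to_inv] at this
    exact this.eventually hTC
  have hAK : ∀ᶠ v in 𝓝 v₀, ‖A v‖ < ‖A v₀‖ + 1 :=
    hA.norm.eventually_lt continuousAt_const (lt_add_one _)
  obtain ⟨ε, hε, hball⟩ := Metric.eventually_nhds_iff_ball.1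
    ((hTC'.and hAK).and (isOpen_extChartAt_target (I := 𝓘(ℝ, E)) g₀ |>.mem_nhds
      (mem_extChartAt_target g₀)))
  let b' : Module.Basis ι ℝ E := b
  obtain ⟨K, hK, hbK⟩ := b'.exists_opNorm_le (F := H)
  have hcont : ContinuousAt e g₀ := continuousAt_extChartAt g₀
  refine ⟨fun g => C * K * (‖A v₀‖ + 1) * ‖e g - v₀‖, fun g => by positivity, ?_, ?_⟩
  · have : Tendsto (fun g => e g - v₀) (𝓝 g₀) (𝓝 0) := by
      have h := hcont.tendsto.sub_const v₀
      rwa [← hv₀, sub_self] at h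
    simpa using (this.norm.const_mul (C * K * (‖A v₀‖ + 1)))
  filter_upwards [hcont.preimage_mem_nhds (Metric.ball_mem_nhds v₀ hε),
    extChartAt_source_mem_nhds (I := 𝓘(ℝ, E)) g₀] with g hg hgs φ M hM hφ
  let u : E →L[ℝ] H := mfderiv 𝓘(ℝ, E) 𝓘(ℝ, H) (fun g : G => T g φ) 1
  have hu : ‖u‖ ≤ K * M := hbK hM hφ
  have hder : ∀ v ∈ Metric.ball v₀ ε, HasFDerivWithinAt (fun v => T (e.symm v) (φ : H))
      (((hT.toCLM (e.symm v)).restrictScalars ℝ).comp (u.comp (A v))) (Metric.ball v₀ ε) v := by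
    intro v hv
    have hm : ContMDiffAt 𝓘(ℝ, E) 𝓘(ℝ, E) ∞ (fun w => (e.symm v)⁻¹ * e.symm w) v :=
      contMDiffAt_const.mul (hsymm.contMDiffAt
        ((isOpen_extChartAt_target (I := 𝓘(ℝ, E)) g₀).mem_nhds (hball v hv).2))
    exact (hT.hasMFDerivAt_orbit_comp (hD.differentiable φ φ.2)
      (hm.mdifferentiableAt (by simp)).hasMFDerivAt).hasFDerivAt.hasFDerivWithinAt
  have hbound : ∀ v ∈ Metric.ball v₀ ε,
      ‖((hT.toCLM (e.symm v)).restrictScalars ℝ).comp (u.comp (A v))‖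
        ≤ C * K * (‖A v₀‖ + 1) * M := by
    intro v hv
    refine ContinuousLinearMap.opNorm_le_bound _ (by positivity) fun w => ?_
    calc ‖T (e.symm v) (u (A v w))‖ ≤ C * ‖u (A v w)‖ := (hball v hv).1.1 _
      _ ≤ C * (K * M * ((‖A v₀‖ + 1) * ‖w‖)) := by
        gcongr
        exact (u.le_opNorm _).trans (mul_le_mul hu (((A v).le_opNorm w).trans
          (by gcongr; exact (hball v hv).1.2.le)) (norm_nonneg _) (by positivity))
      _ = _ := by ring
  have := (convex_ball v₀ ε).norm_image_sub_le_of_norm_hasFDerivWithin_le hder hbound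
    (Metric.mem_ball_self hε) hg
  rw [hv₀, he, extChartAt_to_inv, (extChartAt 𝓘(ℝ, E) g₀).left_inv hgs] at this
  exact this.trans (le_of_eq (by ring))

end Basis

end Domain

/-! ### The representation on the Hilbert scale and on its projective limit -/

section ScaleRep

variable {G : Type*} [TopologicalSpace G] [Group G]
  {H : Type*} [NormedAddCommGroup H] [InnerProductSpace ℂ H] {D : Submodule ℂ H}
  {ι : Type*} [Fintype ι]

/-- What the construction of the representation on the scale of the operators `Xᵢ` uses: `T` leaves
`D` invariant, with restriction `R`; conjugation by `T` mixes the `Xᵢ` with continuous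
coefficients `a`; the orbit maps are norm continuous, uniformly on the vectors of `D` on which the
`Xᵢ` are bounded; and each `Xᵢ` is the velocity of some flow line. -/
structure IsScaleRep (T : Representation ℂ G H) (X : ι → D →ₗ[ℂ] D) (R : G → D →ₗ[ℂ] D)
    (a : G → ι → ι → ℝ) : Prop where
  continuousRep : IsContinuousRep T
  coe_rep : ∀ g φ, (R g φ : H) = T g φ
  continuous_coeff : ∀ i j, Continuous fun g => a g i j
  operator_rep : ∀ g i φ, X i (R g φ) = ∑ j, (a g i j : ℂ) • R g (X j φ)
  exists_norm_sub_le : ∀ g₀, ∃ r : G → ℝ, (∀ g, 0 ≤ r g) ∧ Tendsto r (𝓝 g₀) (𝓝 0) ∧ ∀ᶠ g in 𝓝 g₀,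
    ∀ (φ : D) (M : ℝ), 0 ≤ M → (∀ i, ‖(X i φ : H)‖ ≤ M) → ‖T g (φ : H) - T g₀ (φ : H)‖ ≤ r g * M
  exists_isFlowLine : ∀ i, ∃ c δ, IsFlowLine T (X i) c δ

namespace IsScaleRep

variable {T : Representation ℂ G H} {X : ι → D →ₗ[ℂ] D} {R : G → D →ₗ[ℂ] D}
  {a : G → ι → ι → ℝ}

/-- The coefficients of `Xᵢ T(g) = ∑ⱼ aᵢⱼ(g) T(g) Xⱼ` bound `T g` in every norm of the scale. -/
lemma norm_rep_le (h : IsScaleRep T X R a) {g : G} {C : ℝ} (hC : 0 ≤ C)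
    (hg : ∀ φ, ‖T g φ‖ ≤ C * ‖φ‖) (n : ℕ) (φ : D) :
    ‖PreScale.of X n (R g φ)‖ ≤ (1 + ∑ i, ∑ j, |a g i j|) ^ n * C * ‖PreScale.of X n φ‖ := by
  induction n generalizing φ with
  | zero =>
    rw [PreScale.norm_of_zero, PreScale.norm_of_zero, Submodule.coe_norm, Submodule.coe_norm,
      h.coe_rep]
    simpa using hg φ
  | succ n ih =>
    set B := (1 + ∑ i, ∑ j, |a g i j|) ^ n * C
    have hB : 0 ≤ B := by positivity
    have h1 : ∀ i, ‖PreScale.of X n (X i (R g φ))‖ ≤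
        (∑ j, |a g i j|) * (B * ‖PreScale.of X (n + 1) φ‖) := fun i => by
      rw [h.operator_rep, map_sum, Finset.sum_mul]
      refine (norm_sum_le _ _).trans (Finset.sum_le_sum fun j _ => ?_)
      rw [map_smul, norm_smul, Complex.norm_real, Real.norm_eq_abs]
      gcongr
      exact (ih _).trans (by gcongr; exact PreScale.norm_of_op_le X n j φ)
    calc _ ≤ _ := PreScale.norm_of_succ_le X n _
      _ ≤ ∑ i, (∑ j, |a g i j|) * (B * ‖PreScale.of X (n + 1) φ‖)
          + B * ‖PreScale.of X (n + 1) φ‖ := by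
        gcongr with i
        · exact h1 i
        · exact (ih _).trans (by gcongr; exact PreScale.norm_of_le_succ X n φ)
      _ = _ := by rw [← Finset.sum_mul]; simp only [B]; ring

/-- The continuous extension of `T g` to `Hₙ`. -/
def scaleRep (h : IsScaleRep T X R a) (n : ℕ) (g : G) : HilbertScale X n →L[ℂ] HilbertScale X n :=
  HilbertScale.extend (R g) _ (h.norm_rep_le (norm_nonneg _)
    (fun φ => (h.continuousRep.toCLM g).le_opNorm φ) n)

lemma scaleRep_ofDomain (h : IsScaleRep T X R a) (n : ℕ) (g : G) (φ : D) :
    h.scaleRep n g (HilbertScale.ofDomain X n φ) = HilbertScale.ofDomain X n (R g φ) :=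
  HilbertScale.extend_ofDomain _ _ _ φ

attribute [irreducible] scaleRep

lemma step_scaleRep (h : IsScaleRep T X R a) (n : ℕ) (g : G) (f : HilbertScale X (n + 1)) :
    HilbertScale.step X n (h.scaleRep (n + 1) g f) =
      h.scaleRep n g (HilbertScale.step X n f) :=
  HilbertScale.eq_of_forall_ofDomain
    (f := fun f => HilbertScale.step X n (h.scaleRep (n + 1) g f))
    (g := fun f => h.scaleRep n g (HilbertScale.step X n f)) (by fun_prop) (by fun_prop)
    (fun φ => by simp only [scaleRep_ofDomain, HilbertScale.step_ofDomain]) f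

lemma scaleRep_one (h : IsScaleRep T X R a) (n : ℕ) (f : HilbertScale X n) : h.scaleRep n 1 f = f :=
  HilbertScale.eq_of_forall_ofDomain (f := h.scaleRep n 1) (g := fun f => f)
    (by fun_prop) (by fun_prop)
    (fun φ => by
      rw [scaleRep_ofDomain]
      congr 1
      exact Subtype.ext (by rw [h.coe_rep, map_one]; rfl)) f

lemma scaleRep_mul (h : IsScaleRep T X R a) (n : ℕ) (g₁ g₂ : G) (f : HilbertScale X n) :
    h.scaleRep n (g₁ * g₂) f = h.scaleRep n g₁ (h.scaleRep n g₂ f) :=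
  HilbertScale.eq_of_forall_ofDomain (f := h.scaleRep n (g₁ * g₂))
    (g := fun f => h.scaleRep n g₁ (h.scaleRep n g₂ f)) (by fun_prop) (by fun_prop)
    (fun φ => by
      simp only [scaleRep_ofDomain]
      congr 1
      exact Subtype.ext (by rw [h.coe_rep, h.coe_rep, h.coe_rep, map_mul]; rfl)) f

/-- One neighbourhood of `g₀` serves for the bounds in all the norms. -/
lemma exists_nhds_norm_scaleRep_le (h : IsScaleRep T X R a) (g₀ : G) :
    ∃ U ∈ 𝓝 g₀, ∀ n, ∃ C, 0 ≤ C ∧ ∀ g ∈ U, ∀ f, ‖h.scaleRep n g f‖ ≤ C * ‖f‖ := by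
  obtain ⟨C, hC, hU⟩ := h.continuousRep.exists_norm_le g₀
  set A : G → ℝ := fun g => ∑ i, ∑ j, |a g i j| with hA
  have hAc : Continuous A :=
    continuous_finsetSum _ fun i _ => continuous_finsetSum _ fun j _ => (h.continuous_coeff i j).abs
  have hA0 : ∀ g, 0 ≤ A g := fun g =>
    Finset.sum_nonneg fun i _ => Finset.sum_nonneg fun j _ => abs_nonneg _
  have hU' : ∀ᶠ g in 𝓝 g₀, A g < A g₀ + 1 :=
    hAc.continuousAt.eventually_lt continuousAt_const (lt_add_one _)
  refine ⟨_, hU.and hU', fun n => ⟨(1 + (A g₀ + 1)) ^ n * C, ?_, fun g hg f => ?_⟩⟩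
  · have := hA0 g₀; positivity
  · refine HilbertScale.le_of_forall_ofDomain (f := fun f => ‖h.scaleRep n g f‖)
      (g := fun f => (1 + (A g₀ + 1)) ^ n * C * ‖f‖) (by fun_prop) (by fun_prop) (fun φ => ?_) f
    rw [scaleRep_ofDomain, HilbertScale.norm_ofDomain, HilbertScale.norm_ofDomain]
    refine (h.norm_rep_le hC hg.1 n φ).trans ?_
    have h1 : 0 ≤ A g := hA0 g
    have h2 : A g ≤ A g₀ + 1 := hg.2.le
    change (1 + A g) ^ n * C * _ ≤ _
    gcongr

/-- As a map to the bounded operators from `Hₙ₊₁` to `Hₙ`, the representation is norm continuous.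
The relation between `Xᵢ` and `T g` raises the estimate from one norm to the next. -/
lemma exists_norm_rep_sub_le (h : IsScaleRep T X R a) (g₀ : G) (n : ℕ) :
    ∃ r : G → ℝ, (∀ g, 0 ≤ r g) ∧ Tendsto r (𝓝 g₀) (𝓝 0) ∧ ∀ᶠ g in 𝓝 g₀, ∀ φ : D,
      ‖PreScale.of X n (R g φ - R g₀ φ)‖ ≤ r g * ‖PreScale.of X (n + 1) φ‖ := by
  induction n with
  | zero =>
    obtain ⟨r, hr0, hr, hU⟩ := h.exists_norm_sub_le g₀
    refine ⟨r, hr0, hr, ?_⟩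
    filter_upwards [hU] with g hg φ
    rw [PreScale.norm_of_zero, Submodule.coe_norm, Submodule.coe_sub, h.coe_rep, h.coe_rep]
    refine hg φ _ (norm_nonneg _) fun i => ?_
    have := PreScale.norm_of_op_le X 0 i φ
    rwa [PreScale.norm_of_zero] at this
  | succ n ih =>
    obtain ⟨r, hr0, hr, hU⟩ := ih
    obtain ⟨U, hU₁, hbd⟩ := h.exists_nhds_norm_scaleRep_le g₀
    obtain ⟨C, hC, hCU⟩ := hbd n
    refine ⟨fun g => ∑ i, ∑ j, (|a g i j - a g₀ i j| * C + |a g₀ i j| * r g) + r g,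
      fun g => ?_, ?_, ?_⟩
    · have := hr0 g; positivity
    · have h1 : ∀ i j, Tendsto (fun g => |a g i j - a g₀ i j| * C + |a g₀ i j| * r g)
          (𝓝 g₀) (𝓝 0) := fun i j => by
        have h2 := ((h.continuous_coeff i j).tendsto g₀).sub_const (a g₀ i j)
        rw [sub_self] at h2
        simpa using (h2.abs.mul_const C).add (hr.const_mul |a g₀ i j|)
      have h3 := (tendsto_finsetSum Finset.univ fun i _ =>
        tendsto_finsetSum Finset.univ fun j _ => h1 i j).add hr
      simpa using h3
    · filter_upwards [hU, hU₁] with g hg hgU φ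
      have hR : ∀ φ : D, ‖PreScale.of X n (R g φ)‖ ≤ C * ‖PreScale.of X n φ‖ := fun φ => by
        have := hCU g hgU (HilbertScale.ofDomain X n φ)
        rwa [scaleRep_ofDomain, HilbertScale.norm_ofDomain, HilbertScale.norm_ofDomain] at this
      have h1 : ∀ i, ‖PreScale.of X n (X i (R g φ - R g₀ φ))‖ ≤
          (∑ j, (|a g i j - a g₀ i j| * C + |a g₀ i j| * r g)) *
            ‖PreScale.of X (n + 2) φ‖ := fun i => by
        have h2 : X i (R g φ - R g₀ φ) = ∑ j, (((a g i j - a g₀ i j : ℝ) : ℂ) • R g (X j φ) +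
            (a g₀ i j : ℂ) • (R g (X j φ) - R g₀ (X j φ))) := by
          rw [map_sub, h.operator_rep, h.operator_rep, ← Finset.sum_sub_distrib]
          refine Finset.sum_congr rfl fun j _ => ?_
          rw [Complex.ofReal_sub, sub_smul, smul_sub]
          abel
        rw [h2, map_sum, Finset.sum_mul]
        refine (norm_sum_le _ _).trans (Finset.sum_le_sum fun j _ => ?_)
        rw [map_add, map_smul, map_smul]
        refine (norm_add_le _ _).trans ?_
        rw [norm_smul, norm_smul, Complex.norm_real, Complex.norm_real, Real.norm_eq_abs,
          Real.norm_eq_abs, add_mul, mul_assoc, mul_assoc]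
        have h3 : ‖PreScale.of X (n + 1) (X j φ)‖ ≤ ‖PreScale.of X (n + 2) φ‖ :=
          PreScale.norm_of_op_le X (n + 1) j φ
        have h4 := (PreScale.norm_of_le_succ X n (X j φ)).trans h3
        gcongr
        · exact (hR _).trans (by gcongr)
        · exact (hg _).trans (by have := hr0 g; gcongr)
      have h5 : ‖PreScale.of X (n + 1) φ‖ ≤ ‖PreScale.of X (n + 2) φ‖ :=
        PreScale.norm_of_le_succ X (n + 1) φ
      calc _ ≤ _ := PreScale.norm_of_succ_le X n _
        _ ≤ ∑ i, (∑ j, (|a g i j - a g₀ i j| * C + |a g₀ i j| * r g)) *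
              ‖PreScale.of X (n + 2) φ‖ + r g * ‖PreScale.of X (n + 2) φ‖ := by
          gcongr with i
          · exact h1 i
          · exact (hg φ).trans (by have := hr0 g; gcongr)
        _ = _ := by rw [← Finset.sum_mul, ← add_mul]

/-- The operators from `Hₙ₊₁` to `Hₙ` depend norm continuously on the group element. -/
lemma exists_norm_scaleRep_sub_le (h : IsScaleRep T X R a) (g₀ : G) (n : ℕ) :
    ∃ r : G → ℝ, (∀ g, 0 ≤ r g) ∧ Tendsto r (𝓝 g₀) (𝓝 0) ∧ ∀ᶠ g in 𝓝 g₀,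
      ∀ f : HilbertScale X (n + 1), ‖h.scaleRep n g (HilbertScale.step X n f) -
        h.scaleRep n g₀ (HilbertScale.step X n f)‖ ≤ r g * ‖f‖ := by
  obtain ⟨r, hr0, hr, hU⟩ := h.exists_norm_rep_sub_le g₀ n
  refine ⟨r, hr0, hr, ?_⟩
  filter_upwards [hU] with g hg f
  refine HilbertScale.le_of_forall_ofDomain
    (f := fun f => ‖h.scaleRep n g (HilbertScale.step X n f) -
      h.scaleRep n g₀ (HilbertScale.step X n f)‖)
    (g := fun f => r g * ‖f‖) (by fun_prop) (by fun_prop) (fun φ => ?_) f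
  rw [HilbertScale.step_ofDomain, scaleRep_ofDomain, scaleRep_ofDomain, ← map_sub,
    HilbertScale.norm_ofDomain, HilbertScale.norm_ofDomain]
  exact hg φ

/-- Local boundedness and continuity of the orbits of `D` give joint continuity. -/
lemma continuous_scaleRep (h : IsScaleRep T X R a) (n : ℕ) :
    Continuous fun p : G × HilbertScale X n => h.scaleRep n p.1 p.2 := by
  refine continuous_iff_continuousAt.2 fun ⟨g₀, f₀⟩ => ?_
  obtain ⟨U, hU, hbd⟩ := h.exists_nhds_norm_scaleRep_le g₀
  obtain ⟨C, hC, hCU⟩ := hbd n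
  obtain ⟨r, hr0, hr, hrU⟩ := h.exists_norm_scaleRep_sub_le g₀ n
  rw [Metric.continuousAt_iff']
  intro ε hε
  -- `η` absorbs the errors of replacing `f` and `f₀` by a vector `φ` of `D`
  set η := ε / (2 * (3 * C + 1)) with hη
  have hη0 : 0 < η := by positivity
  obtain ⟨φ, hφ⟩ := (HilbertScale.denseRange_ofDomain X n).exists_dist_lt f₀ hη0
  set ψ := HilbertScale.ofDomain X (n + 1) φ
  have h1 : ∀ᶠ g in 𝓝 g₀, r g * ‖ψ‖ < ε / 2 := by
    have h2 := hr.mul_const ‖ψ‖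
    rw [zero_mul] at h2
    exact h2.eventually_lt_const (by positivity)
  have h3 : ∀ᶠ f in 𝓝 f₀, dist f f₀ < η := Metric.ball_mem_nhds f₀ hη0
  filter_upwards [((Filter.eventually_of_mem hU fun g hg => hg).and (hrU.and h1)).prod_nhds h3]
    with p hp
  obtain ⟨⟨hgU, hr1, hr2⟩, hf⟩ := hp
  have h4 := hr1 ψ
  rw [HilbertScale.step_ofDomain] at h4
  set φ' := HilbertScale.ofDomain X n φ
  have h5 : h.scaleRep n p.1 p.2 - h.scaleRep n g₀ f₀ =
      h.scaleRep n p.1 (p.2 - f₀) + h.scaleRep n p.1 (f₀ - φ') +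
        (h.scaleRep n p.1 φ' - h.scaleRep n g₀ φ') - h.scaleRep n g₀ (f₀ - φ') := by
    simp only [map_sub]; abel
  rw [dist_eq_norm] at hφ hf ⊢
  have h6 : C * η + C * η + ε / 2 + C * η < ε := by
    have : (3 * C + 1) * η = ε / 2 := by rw [hη]; field_simp
    nlinarith
  calc ‖h.scaleRep n p.1 p.2 - h.scaleRep n g₀ f₀‖
      ≤ ‖h.scaleRep n p.1 (p.2 - f₀)‖ + ‖h.scaleRep n p.1 (f₀ - φ')‖ +
        ‖h.scaleRep n p.1 φ' - h.scaleRep n g₀ φ'‖ + ‖h.scaleRep n g₀ (f₀ - φ')‖ := by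
        rw [h5]
        exact (norm_sub_le _ _).trans (add_le_add_left (norm_add₃_le) _)
    _ ≤ C * η + C * η + ε / 2 + C * η := by
        gcongr
        · exact (hCU _ hgU _).trans (by gcongr)
        · exact (hCU _ hgU _).trans (by gcongr)
        · exact h4.trans hr2.le
        · exact (hCU _ (mem_of_mem_nhds hU) _).trans (by gcongr)
    _ < ε := h6

lemma continuous_scaleRep_comp (h : IsScaleRep T X R a) {n : ℕ} {Y : Type*} [TopologicalSpace Y]
    {u : Y → G} {v : Y → HilbertScale X n} (hu : Continuous u) (hv : Continuous v) :
    Continuous fun y => h.scaleRep n (u y) (v y) :=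
  (h.continuous_scaleRep n).comp (hu.prodMk hv)

/-- The representation on the projective limit. -/
def limitRep (h : IsScaleRep T X R a) : Representation ℂ G (ProjLimit X) where
  toFun g :=
    { toFun := fun f => ⟨fun n => h.scaleRep n g (f.1 n), fun n => by
        rw [step_scaleRep, f.2 n]⟩
      map_add' := fun f₁ f₂ => Subtype.ext (funext fun n => map_add _ _ _)
      map_smul' := fun c f => Subtype.ext (funext fun n => (h.scaleRep n g).map_smul c (f.1 n)) }
  map_one' := LinearMap.ext fun f => Subtype.ext (funext fun n => h.scaleRep_one n _)
  map_mul' g₁ g₂ := LinearMap.ext fun f => Subtype.ext (funext fun n => h.scaleRep_mul n g₁ g₂ _)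

@[simp] lemma proj_limitRep (h : IsScaleRep T X R a) (g : G) (f : ProjLimit X) (n : ℕ) :
    ProjLimit.proj X n (h.limitRep g f) = h.scaleRep n g (ProjLimit.proj X n f) := rfl

lemma continuous_limitRep (h : IsScaleRep T X R a) : IsContinuousRep h.limitRep :=
  ProjLimit.continuous_iff_proj.2 fun n => by
    simp only [proj_limitRep]
    exact h.continuous_scaleRep_comp continuous_fst
      ((ProjLimit.proj X n).continuous.comp continuous_snd)

section Complete

variable [CompleteSpace H]

lemma toHilbert_scaleRep (h : IsScaleRep T X R a) (n : ℕ) (g : G) (f : HilbertScale X n) :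
    HilbertScale.toHilbert X n (h.scaleRep n g f) = T g (HilbertScale.toHilbert X n f) :=
  HilbertScale.eq_of_forall_ofDomain
    (f := fun f => HilbertScale.toHilbert X n (h.scaleRep n g f))
    (g := fun f => h.continuousRep.toCLM g (HilbertScale.toHilbert X n f))
    (by fun_prop) (by fun_prop)
    (fun φ => by
      simp only [scaleRep_ofDomain, HilbertScale.toHilbert_ofDomain]
      exact h.coe_rep g φ) f

lemma toHilbert_limitRep (h : IsScaleRep T X R a) (g : G) (f : ProjLimit X) :
    ProjLimit.toHilbert X (h.limitRep g f) = T g (ProjLimit.toHilbert X f) :=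
  h.toHilbert_scaleRep 0 g (f.1 0)

/-- The fundamental theorem of calculus along a flow line, extended from `D` to `Hₙ₊₁`. -/
lemma rep_sub_eq_integral (hT : IsContinuousRep T) {Y : D →ₗ[ℂ] D} {c : ℝ → G} {δ : ℝ}
    (hc : IsFlowLine T Y c δ) {n : ℕ} {B : HilbertScale X (n + 1) →L[ℂ] HilbertScale X n}
    (hB : ∀ φ, B (HilbertScale.ofDomain X (n + 1) φ) = HilbertScale.ofDomain X n (Y φ))
    {t : ℝ} (ht : |t| < δ) (f : HilbertScale X (n + 1)) :
    T (c t) (HilbertScale.toHilbert X (n + 1) f) - HilbertScale.toHilbert X (n + 1) f =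
      ∫ s in (0 : ℝ)..t, T (c s) (HilbertScale.toHilbert X n (B f)) := by
  have hcont : Continuous (Function.uncurry fun (f : HilbertScale X (n + 1)) s =>
      T (c s) (HilbertScale.toHilbert X n (B f))) :=
    hT.continuous_comp (hc.continuous.comp continuous_snd)
      (((HilbertScale.toHilbert X n).comp B).continuous.comp continuous_fst)
  refine HilbertScale.eq_of_forall_ofDomain
    (f := fun f => hT.toCLM (c t) (HilbertScale.toHilbert X (n + 1) f) -
      HilbertScale.toHilbert X (n + 1) f)
    (g := fun f => ∫ s in (0 : ℝ)..t, T (c s) (HilbertScale.toHilbert X n (B f)))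
    (by fun_prop)
    (intervalIntegral.continuous_parametric_intervalIntegral_of_continuous hcont
      continuous_const) (fun φ => ?_) f
  simp only [hB, HilbertScale.toHilbert_ofDomain]
  rw [intervalIntegral.integral_eq_sub_of_hasDerivAt (f := fun s => T (c s) (φ : H))]
  · rw [hc.map_zero, map_one]; rfl
  · intro s hs
    refine hc.hasDerivAt s (lt_of_le_of_lt ?_ ht) φ
    have := abs_sub_left_of_mem_uIcc hs
    simpa using this
  · exact (hT.continuous_comp hc.continuous continuous_const).intervalIntegrable _ _

/-- The operators `Xᵢ` are closable: if `f ∈ Hₙ₊₁` vanishes in `H`, then so does the integral of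
`T (c s) (Xᵢ f)` over short intervals, and hence its integrand at `s = 0`. -/
lemma toHilbert_op_eq_zero (h : IsScaleRep T X R a) (n : ℕ) (f : HilbertScale X (n + 1))
    (hf : HilbertScale.toHilbert X (n + 1) f = 0) (i : ι) :
    HilbertScale.toHilbert X n (HilbertScale.op X n i f) = 0 := by
  obtain ⟨c, δ, hc⟩ := h.exists_isFlowLine i
  set ψ := HilbertScale.toHilbert X n (HilbertScale.op X n i f)
  have hcont : Continuous fun s => T (c s) ψ :=
    h.continuousRep.continuous_comp hc.continuous continuous_const
  have h1 := (hcont.integral_hasStrictDerivAt 0 0).hasDerivAt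
  have h2 : (fun t => ∫ s in (0 : ℝ)..t, T (c s) ψ) =ᶠ[𝓝 0] fun _ => 0 := by
    filter_upwards [Metric.ball_mem_nhds (0 : ℝ) hc.pos] with t ht
    rw [Metric.mem_ball, Real.dist_eq, sub_zero] at ht
    rw [← rep_sub_eq_integral h.continuousRep hc (HilbertScale.op_ofDomain X n i) ht f, hf,
      map_zero, sub_zero]
  have h3 := h1.unique ((hasDerivAt_const (0 : ℝ) (0 : H)).congr_of_eventuallyEq h2)
  rw [hc.map_zero, map_one] at h3
  exact h3

lemma injective_toHilbert (h : IsScaleRep T X R a) (n : ℕ) :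
    Function.Injective (HilbertScale.toHilbert X n) :=
  HilbertScale.injective_toHilbert X h.toHilbert_op_eq_zero n

/-- The integral formula along a flow line holds in `Hₙ`, since `Hₙ → H` is injective. -/
lemma scaleRep_sub_eq_integral (h : IsScaleRep T X R a) {Y : D →ₗ[ℂ] D} {c : ℝ → G} {δ : ℝ}
    (hc : IsFlowLine T Y c δ) {n : ℕ} {B : HilbertScale X (n + 1) →L[ℂ] HilbertScale X n}
    (hB : ∀ φ, B (HilbertScale.ofDomain X (n + 1) φ) = HilbertScale.ofDomain X n (Y φ))
    {t : ℝ} (ht : |t| < δ) (f : HilbertScale X (n + 1)) :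
    h.scaleRep n (c t) (HilbertScale.step X n f) - HilbertScale.step X n f =
      ∫ s in (0 : ℝ)..t, h.scaleRep n (c s) (B f) := by
  refine h.injective_toHilbert n ?_
  have hcont : Continuous fun s => h.scaleRep n (c s) (B f) :=
    h.continuous_scaleRep_comp hc.continuous continuous_const
  have hint : IntervalIntegrable (fun s => h.scaleRep n (c s) (B f)) MeasureTheory.volume 0 t :=
    hcont.intervalIntegrable 0 t
  have h1 := ContinuousLinearMap.intervalIntegral_comp_comm (𝕜 := ℂ)
    (HilbertScale.toHilbert X n) hint
  simp only [toHilbert_scaleRep] at h1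
  rw [← rep_sub_eq_integral h.continuousRep hc hB ht f] at h1
  rw [map_sub, toHilbert_scaleRep, HilbertScale.toHilbert_step]
  exact h1

end Complete

end IsScaleRep

end ScaleRep

/-! ### Generators on the projective limit -/

section Generators

variable {H : Type*} [NormedAddCommGroup H] [InnerProductSpace ℂ H] {D : Submodule ℂ H}
  {ι : Type*} [Fintype ι] (X : ι → D →ₗ[ℂ] D)

/-- The continuous extension `Hₙ₊₁ → Hₙ` of `∑ᵢ cᵢ Xᵢ`. -/
def HilbertScale.gen (n : ℕ) (c : ι → ℂ) : HilbertScale X (n + 1) →L[ℂ] HilbertScale X n :=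
  ∑ i, c i • op X n i

lemma HilbertScale.gen_apply (n : ℕ) (c : ι → ℂ) (f : HilbertScale X (n + 1)) :
    gen X n c f = ∑ i, c i • op X n i f := by
  simp [gen]

lemma HilbertScale.gen_ofDomain (n : ℕ) (c : ι → ℂ) (φ : D) :
    gen X n c (ofDomain X (n + 1) φ) = ofDomain X n ((∑ i, c i • X i) φ) := by
  simp [gen_apply, op_ofDomain]

lemma HilbertScale.step_gen (n : ℕ) (c : ι → ℂ) (f : HilbertScale X (n + 2)) :
    step X n (gen X (n + 1) c f) = gen X n c (step X (n + 1) f) := by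
  simp [gen_apply, step_op]

/-- The continuous extension to `Φ` of `∑ᵢ cᵢ Xᵢ`. -/
def ProjLimit.gen (c : ι → ℂ) : ProjLimit X →L[ℂ] ProjLimit X where
  toFun f := ⟨fun n => HilbertScale.gen X n c (proj X (n + 1) f), fun n => by
    rw [HilbertScale.step_gen, step_proj]⟩
  map_add' f₁ f₂ := Subtype.ext (funext fun n => by
    change HilbertScale.gen X n c (proj X (n + 1) (f₁ + f₂)) = _
    rw [map_add, map_add]; rfl)
  map_smul' a f := Subtype.ext (funext fun n => by
    change HilbertScale.gen X n c (proj X (n + 1) (a • f)) = _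
    rw [map_smul, map_smul]; rfl)
  cont := continuous_iff_proj.2 fun n =>
    (HilbertScale.gen X n c).continuous.comp (proj X (n + 1)).continuous

lemma ProjLimit.proj_gen (c : ι → ℂ) (n : ℕ) (f : ProjLimit X) :
    proj X n (gen X c f) = HilbertScale.gen X n c (proj X (n + 1) f) := rfl

variable {X}

variable {G : Type*} [TopologicalSpace G] [Group G] {T : Representation ℂ G H}
  {R : G → D →ₗ[ℂ] D} {a : G → ι → ι → ℝ}

namespace IsScaleRep

lemma exists_norm_limitRep_sub_le (h : IsScaleRep T X R a) (g₀ : G) (n : ℕ) :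
    ∃ r : G → ℝ, (∀ g, 0 ≤ r g) ∧ Tendsto r (𝓝 g₀) (𝓝 0) ∧ ∀ᶠ g in 𝓝 g₀, ∀ f : ProjLimit X,
      ‖ProjLimit.proj X n (h.limitRep g f - h.limitRep g₀ f)‖ ≤
        r g * ‖ProjLimit.proj X (n + 1) f‖ := by
  obtain ⟨r, hr0, hr, hU⟩ := h.exists_norm_scaleRep_sub_le g₀ n
  refine ⟨r, hr0, hr, hU.mono fun g hg f => ?_⟩
  have := hg (ProjLimit.proj X (n + 1) f)
  rwa [ProjLimit.step_proj] at this

variable [CompleteSpace H]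

/-- Difference quotients along a flow line converge to the generator, for the `n`-th norm uniformly
on the sets on which the next norm of the generator is bounded: the error is the mean of
`(T (γ s) - 1) A f` over `s` between `0` and `t`. -/
lemma norm_diffQuotient_sub_gen_le (h : IsScaleRep T X R a) {c : ι → ℂ} {γ : ℝ → G} {δ : ℝ}
    (hγ : IsFlowLine T (∑ i, c i • X i) γ δ) (n : ℕ) {ε : ℝ} (hε : 0 < ε) :
    ∀ᶠ t : ℝ in 𝓝[≠] 0, ∀ f : ProjLimit X,
      ‖ProjLimit.proj X n ((t : ℂ)⁻¹ • (h.limitRep (γ t) f - f) - ProjLimit.gen X c f)‖ ≤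
        ε * ‖ProjLimit.proj X (n + 1) (ProjLimit.gen X c f)‖ := by
  obtain ⟨r, hr0, hr, hU⟩ := h.exists_norm_scaleRep_sub_le 1 n
  have h1 : ∀ᶠ s in 𝓝 (0 : ℝ), ∀ f : HilbertScale X (n + 1),
      ‖h.scaleRep n (γ s) (HilbertScale.step X n f) - HilbertScale.step X n f‖ ≤ ε * ‖f‖ := by
    have h2 : Tendsto γ (𝓝 0) (𝓝 1) := hγ.map_zero ▸ hγ.continuous.tendsto 0
    filter_upwards [h2.eventually hU, h2.eventually (hr.eventually_le_const hε)] with s hs hs' f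
    have := hs f
    rw [scaleRep_one] at this
    exact this.trans (by gcongr)
  obtain ⟨η, hη, hball⟩ := Metric.eventually_nhds_iff.1 h1
  filter_upwards [self_mem_nhdsWithin,
    nhdsWithin_le_nhds (Metric.ball_mem_nhds (0 : ℝ) (lt_min hη hγ.pos))] with t ht0 ht f
  rw [Metric.mem_ball, Real.dist_eq, sub_zero, lt_min_iff] at ht
  have ht0 : t ≠ 0 := ht0
  set y := ProjLimit.proj X n (ProjLimit.gen X c f) with hy
  set z := ProjLimit.proj X (n + 1) (ProjLimit.gen X c f)
  have hyz : HilbertScale.step X n z = y := ProjLimit.step_proj n _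
  have hcont : Continuous fun s => h.scaleRep n (γ s) y :=
    h.continuous_scaleRep_comp hγ.continuous continuous_const
  have h3 := h.scaleRep_sub_eq_integral hγ (HilbertScale.gen_ofDomain X n c) ht.2
    (ProjLimit.proj X (n + 1) f)
  rw [← ProjLimit.proj_gen, ← hy, ProjLimit.step_proj] at h3
  have h4 : h.scaleRep n (γ t) (ProjLimit.proj X n f) - ProjLimit.proj X n f - t • y =
      ∫ s in (0 : ℝ)..t, (h.scaleRep n (γ s) y - y) := by
    rw [intervalIntegral.integral_sub (hcont.intervalIntegrable 0 t)
      (continuous_const.intervalIntegrable 0 t), ← h3, intervalIntegral.integral_const, sub_zero]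
  have h5 : ‖∫ s in (0 : ℝ)..t, (h.scaleRep n (γ s) y - y)‖ ≤ ε * ‖z‖ * |t - 0| := by
    refine intervalIntegral.norm_integral_le_of_norm_le_const fun s hs => ?_
    have hs' : |s - 0| ≤ |t - 0| := abs_sub_left_of_mem_uIcc (uIoc_subset_uIcc hs)
    rw [sub_zero, sub_zero] at hs'
    have := hball (y := s) (by rw [Real.dist_eq, sub_zero]; exact hs'.trans_lt ht.1) z
    rwa [hyz] at this
  have h6 : ProjLimit.proj X n ((t : ℂ)⁻¹ • (h.limitRep (γ t) f - f) - ProjLimit.gen X c f) =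
      (t : ℂ)⁻¹ • (h.scaleRep n (γ t) (ProjLimit.proj X n f) - ProjLimit.proj X n f - t • y) := by
    have h7 : (t : ℂ)⁻¹ • (t • y) = y := by
      rw [← Complex.coe_smul, inv_smul_smul₀ (Complex.ofReal_ne_zero.2 ht0)]
    rw [smul_sub _ _ (t • y), h7, map_sub, map_smul, map_sub, proj_limitRep]
  rw [h6, h4, norm_smul, norm_inv, Complex.norm_real, Real.norm_eq_abs,
    inv_mul_le_iff₀ (abs_pos.2 ht0)]
  rw [sub_zero] at h5
  linarith

lemma tendsto_diffQuotient (h : IsScaleRep T X R a) {c : ι → ℂ} {γ : ℝ → G} {δ : ℝ}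
    (hγ : IsFlowLine T (∑ i, c i • X i) γ δ) (f : ProjLimit X) :
    Tendsto (fun t : ℝ => (t : ℂ)⁻¹ • (h.limitRep (γ t) f - f)) (𝓝[≠] 0)
      (𝓝 (ProjLimit.gen X c f)) := by
  refine ProjLimit.tendsto_iff_proj.2 fun n => ?_
  rw [tendsto_iff_norm_sub_tendsto_zero]
  set M := ‖ProjLimit.proj X (n + 1) (ProjLimit.gen X c f)‖
  refine Metric.tendsto_nhds.2 fun ε hε => ?_
  filter_upwards [h.norm_diffQuotient_sub_gen_le hγ n
    (show 0 < ε / (2 * (M + 1)) by positivity)] with t ht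
  rw [dist_zero_right, norm_norm, ← map_sub]
  refine (ht f).trans_lt ?_
  have hM : 0 ≤ M := norm_nonneg _
  change ε / (2 * (M + 1)) * M < ε
  rw [div_mul_eq_mul_div, div_lt_iff₀ (by positivity)]
  nlinarith

end IsScaleRep

end Generators

/-! ### The rigged Hilbert space -/

section Rigged

variable {Φ H : Type*} [NormedAddCommGroup H] [InnerProductSpace ℂ H]
  [AddCommGroup Φ] [Module ℂ Φ]

lemma WeakAntidual.tendsto_iff [TopologicalSpace Φ] {α : Type*} {l : Filter α}
    {u : α → WeakAntidual Φ} {F : WeakAntidual Φ} :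
    Tendsto u l (𝓝 F) ↔ ∀ φ, Tendsto (fun x => u x φ) l (𝓝 (F φ)) :=
  PointwiseConvergenceCLM.tendsto_iff_forall_tendsto

/-- On a barrelled space, the weak* limit of a sequence of functionals is continuous. -/
lemma isSeqCompleteSpace_weakAntidual [UniformSpace Φ] [IsUniformAddGroup Φ] [ContinuousSMul ℂ Φ]
    [BarrelledSpace ℂ Φ] : IsSeqCompleteSpace (WeakAntidual Φ) := by
  intro u hu
  have h1 : ∀ φ : Φ, ∃ z, Tendsto (fun n => u n φ) atTop (𝓝 z) := fun φ =>
    cauchySeq_tendsto_of_complete ((hu.map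
      (PointwiseConvergenceCLM.evalCLM (σ := starRingEnd ℂ) ℂ φ).uniformContinuous))
  choose f hf using h1
  have hlim : Tendsto (fun n φ => u n φ) atTop (𝓝 f) := tendsto_pi_nhds.2 hf
  let F : Φ →L⋆[ℂ] ℂ :=
    continuousLinearMapOfTendsto (𝕜₁ := ℂ) (𝕜₂ := ℂ) (fun n => (u n : Φ →L⋆[ℂ] ℂ)) hlim
  exact ⟨F, WeakAntidual.tendsto_iff.2 hf⟩

/-- If `F_k → F` weak* and `φ_k → φ`, then `F_k φ_k → F φ`: by the Banach-Steinhaus theorem a weak*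
convergent sequence is equicontinuous. -/
lemma WeakAntidual.tendsto_apply [UniformSpace Φ] [IsUniformAddGroup Φ] [ContinuousSMul ℂ Φ]
    [BarrelledSpace ℂ Φ] {u : ℕ → WeakAntidual Φ} {F : WeakAntidual Φ} {v : ℕ → Φ} {φ : Φ}
    (hu : Tendsto u atTop (𝓝 F)) (hv : Tendsto v atTop (𝓝 φ)) :
    Tendsto (fun k => u k (v k)) atTop (𝓝 (F φ)) := by
  have hu' := WeakAntidual.tendsto_iff.1 hu
  have h1 : UniformEquicontinuous ((↑) ∘ fun k => (u k : Φ →L⋆[ℂ] ℂ)) :=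
    PolynormableSpace.banach_steinhaus (𝕜₁ := ℂ) (𝕜₂ := ℂ) fun ψ =>
      (hu' ψ).isVonNBounded_range ℂ
  have h2 := Metric.equicontinuousAt_iff_right.1 (h1.equicontinuous φ)
  have h3 : Tendsto (fun k => u k (v k) - u k φ) atTop (𝓝 0) := by
    refine Metric.tendsto_nhds.2 fun ε hε => ?_
    filter_upwards [hv.eventually (h2 ε hε)] with k hk
    have := hk k
    rw [dist_comm, dist_eq_norm] at this
    rw [dist_zero_right]
    exact this
  simpa using h3.add (hu' φ)

variable [TopologicalSpace Φ] {j : Φ →L[ℂ] H}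

lemma toAntidual_apply (h : H) (φ : Φ) : toAntidual j h φ = inner ℂ (j φ) h := rfl

lemma injective_toAntidual (hj : DenseRange j) : Function.Injective (toAntidual j) :=
  (injective_iff_map_eq_zero _).2 fun _ hh =>
    hj.eq_zero_of_inner_right ℂ fun φ => DFunLike.congr_fun hh φ

lemma continuous_toAntidual : Continuous (toAntidual j) :=
  PointwiseConvergenceCLM.continuous_of_continuous_eval fun φ => by
    simp only [toAntidual_apply]; fun_prop

/-- The values of an antilinear functional at finitely many vectors are the values of a functional
`⟪j ·, h⟫`, by the Riesz representation theorem in the image under `j` of their span. -/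
lemma exists_toAntidual_eq (hj : Function.Injective j) (F : Φ →ₛₗ[starRingEnd ℂ] ℂ) {s : Set Φ}
    (hs : s.Finite) : ∃ h, ∀ φ ∈ s, toAntidual j h φ = F φ := by
  let V := Submodule.span ℂ s
  have hV : FiniteDimensional ℂ V := FiniteDimensional.span_of_finite ℂ hs
  let jV : V →ₗ[ℂ] H := j.toLinearMap ∘ₗ V.subtype
  have hjV : Function.Injective jV := hj.comp Subtype.val_injective
  let e := LinearEquiv.ofInjective jV hjV
  let l : V →ₗ[ℂ] ℂ :=
    { toFun := fun φ => starRingEnd ℂ (F φ)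
      map_add' := fun φ ψ => by simp
      map_smul' := fun c φ => by simp }
  let l' : LinearMap.range jV →L[ℂ] ℂ :=
    LinearMap.toContinuousLinearMap (l ∘ₗ e.symm.toLinearMap)
  have : CompleteSpace (LinearMap.range jV) := FiniteDimensional.complete ℂ _
  let w := (InnerProductSpace.toDual ℂ (LinearMap.range jV)).symm l'
  refine ⟨w, fun φ hφ => ?_⟩
  let φ' : V := ⟨φ, Submodule.subset_span hφ⟩
  have h1 : inner ℂ w (e φ') = l' (e φ') := InnerProductSpace.toDual_symm_apply
  have h2 : l' (e φ') = starRingEnd ℂ (F φ) := by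
    change l (e.symm (e φ')) = _
    rw [e.symm_apply_apply]; rfl
  have h3 : inner ℂ (w : H) (j φ) = starRingEnd ℂ (F φ) := h1.trans h2
  rw [toAntidual_apply, ← inner_conj_symm, h3, Complex.conj_conj]

lemma denseRange_toAntidual (hj : Function.Injective j) : DenseRange (toAntidual j) := by
  intro F
  rw [mem_closure_iff_nhds]
  intro U hU
  rw [(PointwiseConvergenceCLM.isEmbedding_coeFn _ _ _).isInducing.nhds_eq_comap, mem_comap] at hU
  obtain ⟨V, hV, hVU⟩ := hU
  rw [nhds_pi, Filter.mem_pi] at hV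
  obtain ⟨I, hI, t, ht, htV⟩ := hV
  obtain ⟨h, hh⟩ := exists_toAntidual_eq hj (F : Φ →L⋆[ℂ] ℂ).toLinearMap hI
  refine ⟨toAntidual j h, hVU (htV fun φ hφ => ?_), mem_range_self h⟩
  have h1 : toAntidual j h φ = F φ := hh φ hφ
  rw [h1]
  exact mem_of_mem_nhds (ht φ)

end Rigged

/-- The projective limit of a scale of closable operators on a dense domain. -/
lemma isRiggedHilbertSpace_toHilbert {H : Type*} [NormedAddCommGroup H] [InnerProductSpace ℂ H]
    [CompleteSpace H] {D : Submodule ℂ H} (hD : Dense (D : Set H)) {ι : Type*} [Fintype ι]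
    {X : ι → D →ₗ[ℂ] D} (hinj : ∀ n, Function.Injective (HilbertScale.toHilbert X n)) :
    IsRiggedHilbertSpace (ProjLimit.toHilbert X) := by
  have hj := ProjLimit.injective_toHilbert X hinj
  have hdense : DenseRange (ProjLimit.toHilbert X) :=
    hD.mono fun φ hφ => ⟨ProjLimit.ofDomain X ⟨φ, hφ⟩, ProjLimit.toHilbert_ofDomain X _⟩
  exact
    { complete_hilbert := inferInstance
      locallyConvex := inferInstance
      complete := inferInstance
      injective := hj
      dense := hdense
      antidual_complete := isSeqCompleteSpace_weakAntidual
      antidual_injective := injective_toAntidual hdense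
      antidual_continuous := continuous_toAntidual
      antidual_dense := denseRange_toAntidual hj }

/-! ### The dual representation -/

section Dual

variable {G : Type*} [TopologicalSpace G] [Group G]
  {Φ : Type*} [AddCommGroup Φ] [Module ℂ Φ]

lemma StrongAntidual.tendsto_iff [TopologicalSpace Φ] {α : Type*} {l : Filter α}
    {u : α → StrongAntidual Φ} {F : StrongAntidual Φ} :
    Tendsto u l (𝓝 F) ↔ ∀ B, Bornology.IsVonNBounded ℂ B → ∀ ε > 0, ∀ᶠ x in l,
      ∀ φ ∈ B, ‖u x φ - F φ‖ < ε := by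
  have h := UniformConvergenceCLM.tendsto_iff_tendstoUniformlyOn (σ := starRingEnd ℂ) (F := ℂ)
    {B : Set Φ | Bornology.IsVonNBounded ℂ B} (p := l) (a := u) (a₀ := F)
  refine h.trans (forall₂_congr fun B _ => ?_)
  rw [Metric.tendstoUniformlyOn_iff]
  refine forall₂_congr fun ε _ => eventually_congr (Eventually.of_forall fun x =>
    forall₂_congr fun φ _ => ?_)
  rw [dist_comm, dist_eq_norm]
  rfl

section Rep

variable [TopologicalSpace Φ] {S : Representation ℂ G Φ}

/-- The representation `(V g F) φ = F (S g⁻¹ φ)` on the weak* antidual. -/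
def weakDualRep (hS : IsContinuousRep S) : Representation ℂ G (WeakAntidual Φ) where
  toFun g := (PointwiseConvergenceCLM.precomp ℂ (hS.toCLM g⁻¹)).toLinearMap
  map_one' := LinearMap.ext fun F => ContinuousLinearMap.ext fun φ => by
    change F (S 1⁻¹ φ) = F φ
    rw [inv_one, map_one]; rfl
  map_mul' g₁ g₂ := LinearMap.ext fun F => ContinuousLinearMap.ext fun φ => by
    change F (S (g₁ * g₂)⁻¹ φ) = F (S g₂⁻¹ (S g₁⁻¹ φ))
    rw [mul_inv_rev, map_mul]; rfl

lemma weakDualRep_apply (hS : IsContinuousRep S) (g : G) (F : WeakAntidual Φ) (φ : Φ) :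
    weakDualRep hS g F φ = F (S g⁻¹ φ) := rfl

/-- The representation `(V g F) φ = F (S g⁻¹ φ)` on the strong antidual. -/
def strongDualRep (hS : IsContinuousRep S) : Representation ℂ G (StrongAntidual Φ) where
  toFun g := (ContinuousLinearMap.precomp ℂ (hS.toCLM g⁻¹)).toLinearMap
  map_one' := LinearMap.ext fun F => ContinuousLinearMap.ext fun φ => by
    change F (S 1⁻¹ φ) = F φ
    rw [inv_one, map_one]; rfl
  map_mul' g₁ g₂ := LinearMap.ext fun F => ContinuousLinearMap.ext fun φ => by
    change F (S (g₁ * g₂)⁻¹ φ) = F (S g₂⁻¹ (S g₁⁻¹ φ))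
    rw [mul_inv_rev, map_mul]; rfl

/-- The difference quotients of the dual representation at `t` are, up to sign, the transposes of
those of `S` at `-t`. -/
lemma apply_diffQuotient_inv {G : Type*} [Group G] {S : Representation ℂ G Φ} {γ : ℝ → G}
    (hγ : ∀ s t, γ (s + t) = γ s * γ t) (F : Φ →L⋆[ℂ] ℂ) (t : ℝ) (φ : Φ) :
    (t : ℂ)⁻¹ • (F (S (γ t)⁻¹ φ) - F φ) = -F (((-t : ℝ) : ℂ)⁻¹ • (S (γ (-t)) φ - φ)) := by
  have h0 : γ 0 = 1 := by simpa using hγ 0 0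
  have h1 : (γ t)⁻¹ = γ (-t) := inv_eq_of_mul_eq_one_right (by rw [← hγ, add_neg_cancel, h0])
  rw [h1, map_smulₛₗ, map_sub, map_inv₀, Complex.conj_ofReal, Complex.ofReal_neg, inv_neg,
    neg_smul, neg_neg]

lemma tendsto_neg_punctured : Tendsto (fun t : ℝ => -t) (𝓝[≠] 0) (𝓝[≠] 0) := by
  refine tendsto_nhdsWithin_iff.2 ⟨?_, ?_⟩
  · have : Tendsto (fun t : ℝ => -t) (𝓝 0) (𝓝 (-0)) := continuous_neg.tendsto 0
    rw [neg_zero] at this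
    exact this.mono_left nhdsWithin_le_nhds
  · filter_upwards [self_mem_nhdsWithin] with t ht
    exact neg_ne_zero.2 ht

end Rep

/-- The weak* dual of a representation with generators on a barrelled space. -/
lemma isSeqDifferentiableRep_weakDualRep (E : Type*) [NormedAddCommGroup E] [NormedSpace ℝ E]
    [ChartedSpace E G] [ContinuousInv G] [UniformSpace Φ] [IsUniformAddGroup Φ]
    [ContinuousSMul ℂ Φ] [BarrelledSpace ℂ Φ] {S : Representation ℂ G Φ} (hS : IsContinuousRep S)
    (hgen : HasGenerators E S) : IsSeqDifferentiableRep E (weakDualRep hS) where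
  complete := isSeqCompleteSpace_weakAntidual
  continuous_operator g := (PointwiseConvergenceCLM.precomp ℂ (hS.toCLM g⁻¹)).continuous
  continuous_orbit F := PointwiseConvergenceCLM.continuous_of_continuous_eval fun φ => by
    simp only [weakDualRep_apply]
    exact (F : Φ →L⋆[ℂ] ℂ).continuous.comp (hS.continuous_comp continuous_inv continuous_const)
  seqContinuous := fun u p hu => by
    have h1 : Tendsto (fun k => (u k).1) atTop (𝓝 p.1) := (continuous_fst.tendsto p).comp hu
    have h2 : Tendsto (fun k => (u k).2) atTop (𝓝 p.2) := (continuous_snd.tendsto p).comp hu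
    refine WeakAntidual.tendsto_iff.2 fun φ => ?_
    have h3 : Continuous fun g : G => S g⁻¹ φ :=
      hS.continuous_comp continuous_inv continuous_const
    change Tendsto (fun k => (u k).2 (S (u k).1⁻¹ φ)) atTop (𝓝 (p.2 (S p.1⁻¹ φ)))
    exact WeakAntidual.tendsto_apply h2 ((h3.tendsto p.1).comp h1)
  generators := fun γ hγ => by
    obtain ⟨A, hA⟩ := hgen γ hγ
    refine ⟨-PointwiseConvergenceCLM.precomp ℂ A, fun F => WeakAntidual.tendsto_iff.2 fun φ => ?_⟩
    have h1 := (((F : Φ →L⋆[ℂ] ℂ).continuous.tendsto _).comp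
      ((hA φ).comp tendsto_neg_punctured)).neg
    refine h1.congr fun t => ?_
    exact (apply_diffQuotient_inv hγ.1 F t φ).symm

end Dual

section StrongDual

variable {G : Type*} [TopologicalSpace G] [Group G]
  {H : Type*} [NormedAddCommGroup H] [InnerProductSpace ℂ H] {D : Submodule ℂ H}
  {ι : Type*} [Fintype ι] {X : ι → D →ₗ[ℂ] D} {T : Representation ℂ G H}
  {R : G → D →ₗ[ℂ] D} {a : G → ι → ι → ℝ}

namespace IsScaleRep

/-- For the strong topology, continuity of the orbit of a functional `F` is uniform convergence of
`F ∘ S g` on bounded sets. It holds since `F` is bounded for some norm `‖·‖ₙ`, and the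
representation is norm continuous from `‖·‖ₙ₊₁` to `‖·‖ₙ`. -/
lemma isContinuousRep_strongDualRep [ContinuousInv G] (h : IsScaleRep T X R a) :
    IsContinuousRep (strongDualRep h.continuous_limitRep) := by
  refine continuous_iff_continuousAt.2 fun ⟨g₀, F₀⟩ => ?_
  refine StrongAntidual.tendsto_iff.2 fun B hB ε hε => ?_
  have hinv : Tendsto (fun g : G => g⁻¹) (𝓝 g₀) (𝓝 g₀⁻¹) := continuous_inv.tendsto g₀
  choose M hM using ProjLimit.isVonNBounded_iff.1 hB
  obtain ⟨U, hU, hbd⟩ := h.exists_nhds_norm_scaleRep_le g₀⁻¹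
  choose C hC hCU using hbd
  -- a bounded set that contains the translates of `B` by the elements of `U`
  have hB' : Bornology.IsVonNBounded ℂ
      {f : ProjLimit X | ∀ n, ‖ProjLimit.proj X n f‖ ≤ C n * M n} :=
    ProjLimit.isVonNBounded_iff.2 fun n => ⟨C n * M n, fun f hf => hf n⟩
  have hF : ∀ᶠ F in 𝓝 F₀, ∀ f ∈ {f : ProjLimit X | ∀ n, ‖ProjLimit.proj X n f‖ ≤ C n * M n},
      ‖F f - F₀ f‖ < ε / 2 :=
    StrongAntidual.tendsto_iff.1 (tendsto_id (x := 𝓝 F₀)) _ hB' (ε / 2) (by positivity)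
  obtain ⟨n, K, hK, hFK⟩ := ProjLimit.exists_norm_apply_le F₀
  obtain ⟨r, hr0, hr, hrU⟩ := h.exists_norm_limitRep_sub_le g₀⁻¹ n
  have h1 : ∀ᶠ g in 𝓝 g₀⁻¹, K * (r g * M (n + 1)) < ε / 2 := by
    have h2 := (hr.mul_const (M (n + 1))).const_mul K
    rw [zero_mul, mul_zero] at h2
    exact h2.eventually_lt_const (by positivity)
  have h3 : ∀ᶠ g in 𝓝 g₀, (g⁻¹ ∈ U) ∧ K * (r g⁻¹ * M (n + 1)) < ε / 2 ∧
      ∀ f : ProjLimit X, ‖ProjLimit.proj X n (h.limitRep g⁻¹ f - h.limitRep g₀⁻¹ f)‖ ≤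
        r g⁻¹ * ‖ProjLimit.proj X (n + 1) f‖ :=
    hinv.eventually ((Filter.eventually_of_mem hU fun g hg => hg).and (h1.and hrU))
  filter_upwards [h3.prod_nhds hF] with p hp f hf
  obtain ⟨⟨hpU, hp1, hp2⟩, hp3⟩ := hp
  change ‖p.2 (h.limitRep p.1⁻¹ f) - F₀ (h.limitRep g₀⁻¹ f)‖ < ε
  have h4 : ‖p.2 (h.limitRep p.1⁻¹ f) - F₀ (h.limitRep p.1⁻¹ f)‖ < ε / 2 :=
    hp3 _ fun m => (hCU m _ hpU _).trans (mul_le_mul_of_nonneg_left (hM m f hf) (hC m))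
  have h5 : ‖F₀ (h.limitRep p.1⁻¹ f) - F₀ (h.limitRep g₀⁻¹ f)‖ < ε / 2 := by
    rw [← map_sub]
    refine ((hFK _).trans ?_).trans_lt hp1
    have := hr0 p.1⁻¹
    exact mul_le_mul_of_nonneg_left ((hp2 f).trans (by gcongr; exact hM _ f hf)) hK
  calc _ ≤ _ := norm_sub_le_norm_sub_add_norm_sub _ (F₀ (h.limitRep p.1⁻¹ f)) _
    _ < ε := by linarith

/-- If every one-parameter subgroup is a flow line of a combination of the `Xᵢ`, the
representation on the projective limit is differentiable. -/
lemma isDifferentiableRep_limitRep [CompleteSpace H] (E : Type*) [NormedAddCommGroup E]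
    [NormedSpace ℝ E] [ChartedSpace E G] (h : IsScaleRep T X R a)
    (hflow : ∀ γ : ℝ → G, IsOneParameterSubgroup E γ →
      ∃ (c : ι → ℂ) (δ : ℝ), IsFlowLine T (∑ i, c i • X i) γ δ) :
    IsDifferentiableRep E h.limitRep where
  complete := inferInstance
  continuous := h.continuous_limitRep
  generators γ hγ := by
    obtain ⟨c, δ, hc⟩ := hflow γ hγ
    exact ⟨ProjLimit.gen X c, h.tendsto_diffQuotient hc⟩

/-- For the strong topology, the difference quotients converge uniformly on bounded sets because
the estimate of `norm_diffQuotient_sub_gen_le` involves only one further norm. -/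
lemma isDifferentiableRep_strongDualRep [CompleteSpace H] (E : Type*) [NormedAddCommGroup E]
    [NormedSpace ℝ E] [ChartedSpace E G] [ContinuousInv G] (h : IsScaleRep T X R a)
    (hflow : ∀ γ : ℝ → G, IsOneParameterSubgroup E γ →
      ∃ (c : ι → ℂ) (δ : ℝ), IsFlowLine T (∑ i, c i • X i) γ δ) :
    IsDifferentiableRep E (strongDualRep h.continuous_limitRep) where
  complete := by
    have : FirstCountableTopology (ProjLimit X) := UniformSpace.firstCountableTopology _
    infer_instance
  continuous := h.isContinuousRep_strongDualRep
  generators γ hγ := by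
    obtain ⟨c, δ, hc⟩ := hflow γ hγ
    set A := ProjLimit.gen X c with hA
    refine ⟨ContinuousLinearMap.precomp ℂ (-A), fun F => StrongAntidual.tendsto_iff.2
      fun B hB ε hε => ?_⟩
    obtain ⟨n, K, hK, hFK⟩ := ProjLimit.exists_norm_apply_le F
    obtain ⟨M, hM⟩ := ProjLimit.isVonNBounded_iff.1 (hB.image A) (n + 1)
    have h1 := tendsto_neg_punctured.eventually (h.norm_diffQuotient_sub_gen_le hc n
      (show 0 < ε / (2 * (K * |M| + 1)) by positivity))
    filter_upwards [h1] with t ht f hf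
    have h2 : ((t : ℂ)⁻¹ • (strongDualRep h.continuous_limitRep (γ t) F - F)) f -
        ContinuousLinearMap.precomp ℂ (-A) F f =
        -F (((-t : ℝ) : ℂ)⁻¹ • (h.limitRep (γ (-t)) f - f) - A f) := by
      have h3 := apply_diffQuotient_inv (S := h.limitRep) hγ.1 F t f
      rw [map_sub, neg_sub, sub_eq_add_neg (F (A f)), ← h3]
      change _ - F (-A f) = _
      rw [map_neg, sub_neg_eq_add, add_comm]; rfl
    rw [h2, norm_neg]
    have hM' : ‖ProjLimit.proj X (n + 1) (A f)‖ ≤ |M| :=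
      (hM _ (mem_image_of_mem A hf)).trans (le_abs_self M)
    refine (hFK _).trans_lt ?_
    calc _ ≤ K * (ε / (2 * (K * |M| + 1)) * |M|) :=
          mul_le_mul_of_nonneg_left ((ht f).trans (by gcongr)) hK
      _ = ε * ((K * |M|) / (2 * (K * |M| + 1))) := by ring
      _ < ε * 1 := by
        have : 0 ≤ K * |M| := by positivity
        gcongr
        rw [div_lt_one (by positivity)]
        linarith
      _ = ε := mul_one ε

end IsScaleRep

end StrongDual

/-- The restriction to an invariant domain of the differential of a representation, in a basis of
the Lie algebra, has the properties on which the construction of the scale rests. -/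
lemma IsInvariantDomain.isScaleRep {E : Type*} [NormedAddCommGroup E] [NormedSpace ℝ E]
    [FiniteDimensional ℝ E] {G : Type*} [TopologicalSpace G] [ChartedSpace E G] [Group G]
    [LieGroup 𝓘(ℝ, E) ∞ G] {H : Type*} [NormedAddCommGroup H] [InnerProductSpace ℂ H]
    {T : Representation ℂ G H} (hT : IsContinuousRep T) {D : Submodule ℂ H}
    (hD : IsInvariantDomain E T D) {ι : Type*} [Fintype ι]
    (b : Module.Basis ι ℝ (GroupLieAlgebra 𝓘(ℝ, E) G)) :
    IsScaleRep T (fun i => hD.operator (b i)) hD.rep (adjointCoeff b) where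
  continuousRep := hT
  coe_rep _ _ := rfl
  continuous_coeff := continuous_adjointCoeff b
  operator_rep := hD.operator_rep b hT
  exists_norm_sub_le := hD.exists_norm_sub_le b hT
  exists_isFlowLine i := hD.exists_isFlowLine hT (b i)

end

/-! ### The rigged Hilbert space of an invariant domain -/

theorem proposition2p1
    {E : Type*} [NormedAddCommGroup E] [NormedSpace ℝ E] [FiniteDimensional ℝ E]
    {G : Type*} [TopologicalSpace G] [ChartedSpace E G] [Group G] [LieGroup 𝓘(ℝ, E) ∞ G]
    {H : Type*} [NormedAddCommGroup H] [InnerProductSpace ℂ H] [CompleteSpace H]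
    (T : Representation ℂ G H) (hT : IsContinuousRep T)
    (D : Submodule ℂ H) (hD : IsInvariantDomain E T D)
    {ι : Type*} [Fintype ι] (b : Module.Basis ι ℝ (GroupLieAlgebra 𝓘(ℝ, E) G))
    (X : ι → D →ₗ[ℂ] D) (hX : X = fun i => hD.operator (b i)) :
    -- the scale consists of subspaces of `H`, and `Φ` is their intersection
    (∀ n, Function.Injective (HilbertScale.toHilbert X n)) ∧
    (∀ n f, HilbertScale.toHilbert X n (HilbertScale.step X n f) =
      HilbertScale.toHilbert X (n + 1) f) ∧
    range (ProjLimit.toHilbert X) = ⋂ n, range (HilbertScale.toHilbert X n) ∧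
    IsRiggedHilbertSpace (ProjLimit.toHilbert X) ∧
    -- the restriction of `T` to `Φ`
    ∃ S : Representation ℂ G (ProjLimit X),
      (∀ g φ, ProjLimit.toHilbert X (S g φ) = T g (ProjLimit.toHilbert X φ)) ∧
      IsContinuousRep S ∧
      (@CompleteSpace D (projUniformSpace X) →
        IsDifferentiableRep E S ∧
        -- the dual representation, for the weak* topology and for the strong topology
        (∃ V : Representation ℂ G (WeakAntidual (ProjLimit X)),
          (∀ g F φ, V g F φ = F (S g⁻¹ φ)) ∧ IsSeqDifferentiableRep E V) ∧
        ∃ V : Representation ℂ G (StrongAntidual (ProjLimit X)),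
          (∀ g F φ, V g F φ = F (S g⁻¹ φ)) ∧ IsDifferentiableRep E V) := by
  subst hX
  have : IsTopologicalGroup G := topologicalGroup_of_lieGroup 𝓘(ℝ, E) ∞
  have h := hD.isScaleRep hT b
  have hinj := h.injective_toHilbert
  have hflow : ∀ γ : ℝ → G, IsOneParameterSubgroup E γ →
      ∃ (c : ι → ℂ) (δ : ℝ), IsFlowLine T (∑ i, c i • hD.operator (b i)) γ δ := fun γ hγ => by
    obtain ⟨x, hx⟩ := hD.exists_isFlowLine_of_isOneParameterSubgroup hT hγ
    refine ⟨fun i => ((b.repr x i : ℝ) : ℂ), 1, ?_⟩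
    have h1 : ∑ i, ((b.repr x i : ℝ) : ℂ) • hD.operator (b i) = hD.operator x :=
      LinearMap.ext fun φ => by
        rw [hD.operator_eq_sum b]
        simp only [LinearMap.sum_apply, LinearMap.smul_apply]
    rw [h1]
    exact hx 1 one_pos
  have hdiff := h.isDifferentiableRep_limitRep E hflow
  exact ⟨hinj, HilbertScale.toHilbert_step _, ProjLimit.range_toHilbert _ hinj,
    isRiggedHilbertSpace_toHilbert hD.dense hinj,
    h.limitRep, h.toHilbert_limitRep, h.continuous_limitRep, fun _ => ⟨hdiff,
      ⟨weakDualRep h.continuous_limitRep, fun _ _ _ => rfl,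
        isSeqDifferentiableRep_weakDualRep E h.continuous_limitRep hdiff.generators⟩,
      strongDualRep h.continuous_limitRep, fun _ _ _ => rfl,
      h.isDifferentiableRep_strongDualRep E hflow⟩⟩
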